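/- Let $G$ be a finite connected simple graph on at least three vertices. For a vertex $v$ and an integer $r\ge 0$ let $M_r(v)$ be the set of vertices at distance at most $r$ from $v$ in $G$, and let the ball $G_r(v)$ be the subgraph of $G$ induced by $M_r(v)$; let $d(x)$ denote the degree of $x$ in $G$. Suppose that $G_3(v)$ is $2$-connected for every vertex $v$ of $G$ (that is, it has at least three vertices and remains connected after the removal of any set of at most one vertex), and that $$d(x)+d(y)+d(z)\ \ge\ |M_3(v)|+2$$ for every vertex $v$ of $G$ and all triples of distinct, pairwise non-adjacent vertices $x,y,z$ of $G_2(v)$. Then every longest cycle $C$ of $G$ is dominating, that is, the set $V(G)\setminus V(C)$ is independent. -/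

import Mathlib

namespace LocalBondy

variable {V : Type*}

/-- `M G r u`: the set of all vertices at distance at most `r` from `u`. -/
def M (G : SimpleGraph V) (r : ℕ) (u : V) : Set V :=
  {v | G.edist u v ≤ r}

/-- The ball of radius `r` centered at `u`: the subgraph of `G` induced by the set of vertices at
distance at most `r` from `u`. -/
def ball (G : SimpleGraph V) (r : ℕ) (u : V) : SimpleGraph (M G r u) :=
  G.induce (M G r u)

/-- `G` is `k`-connected: it has more than `k` vertices, and it stays connected after the removal
of any set of fewer than `k` vertices. -/
def IsKConnected (k : ℕ) (G : SimpleGraph V) : Prop :=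
  (k : ℕ∞) < ENat.card V ∧ ∀ X : Set V, X.encard < k → (G.induce Xᶜ).Connected

/-- A longest cycle: a cycle such that no cycle of `G` has greater length. -/
def IsLongestCycle (G : SimpleGraph V) {c : V} (C : G.Walk c c) : Prop :=
  C.IsCycle ∧ ∀ (d : V) (D : G.Walk d d), D.IsCycle → D.length ≤ C.length

/-- A cycle is dominating if the vertices off the cycle form an independent set. -/
def IsDominating (G : SimpleGraph V) {c : V} (C : G.Walk c c) : Prop :=
  G.IsIndepSet {v | v ∉ C.support}

end LocalBondy

/-! A longest cycle with `l` vertices is encoded as an `l`-periodic map `c` from the integers.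
Suppose that it is not dominating, and let `H` be a component with an edge of what remains
without it. An attachment is a vertex with a neighbour in `H`; the successor and the predecessor
on the cycle of an attachment are not attachments, and a path through `H` between two
attachments is an ear of the cycle.

Every contradiction comes from one count. Take three independent vertices within distance `2` of a
centre, typically the successors of the two ends of an ear and a vertex of `H`. As in Bondy's
proof for the global degree condition, the neighbourhoods of the first two, after moving their
vertices by at most one step along the cycle, are disjoint, since a collision would give a longer
cycle. If the moved sets and the neighbourhood of the third vertex stay in the ball of radius `3`
and overlap little, the degree sum is too small (`TripleBound.false_of_disjoint`). The local
condition thus requires a centre close to all three vertices, and moves that do not leave its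
ball.

* If the successor of one attachment were adjacent to another one, that attachment would be a
  suitable centre. So attachments are not adjacent to cyclic neighbours of other attachments
  (`OffCycle.succ_not_adj`, `OffCycle.pred_not_adj`).
* With an attachment `c 0` itself as the centre, it follows that there is a cycle through all
  other vertices of `c` which avoids `c 0`; it runs along `c` except next to `c 0`
  (`OffCycle.exists_isBypass`).
* On such a bypass `d`, let `d 0` be a neighbour of `c 0` and `d k` an attachment. The path from
  `d k` through `H` and `c 0` to `d 0` is an ear of the bypass, long enough to outweigh the one
  vertex that the bypass may have lost. Counting at the centre `d 0` shows that `d (k + 1)` has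
  distance more than `2` from `d 0` (`OffCycle.notMem_M_two`). On the other hand, if the two
  vertices had no common neighbour, they would violate the degree condition together with a vertex
  `z` of `H`, at any centre close to all three, as long as their neighbourhoods hardly meet that
  of `z` (`OffCycle.mem_M_two_of_center`). So there is no such centre.
* A vertex of `H` with two neighbours on the cycle would be one, hence every vertex of `H` has at
  most one neighbour there (`OffCycle.eq_of_adj`).
* Let `v` be an attachment. Its ball of radius `3` is connected without `v` and contains vertices
  of `H` and the successor of `v`, so it contains an edge from some other attachment to a vertex
  `s` outside `H` that is not an attachment. The neighbour of `v` on a shortest path to `s` is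
  close to `s`, to the successor of `v` on a bypass of the other attachment, and to a neighbour of
  `v` in `H`. This is again impossible; if `s` is not on the bypass, it extends the ear instead
  (`OffCycle.notMem_M_two_of_notMem_range`, `OffCycle.notMem_M_three`,
  `OffCycle.not_isKConnected`).
-/

namespace LocalBondy

section Paths

variable {V : Type*} {G : SimpleGraph V}

/-! ### Paths and cyclic orders -/

/-- `PathOn G a b n S`: some path of `G` from `a` to `b` has exactly `n` vertices, and `S` is the
set of its vertices. -/
def PathOn (G : SimpleGraph V) (a b : V) (n : ℕ) (S : Set V) : Prop :=
  ∃ p : G.Walk a b, p.IsPath ∧ p.length + 1 = n ∧ {x | x ∈ p.support} = S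

theorem PathOn.single (a : V) : PathOn G a a 1 {a} :=
  ⟨.nil, by simp, by simp, by ext; simp⟩

theorem PathOn.reverse {a b : V} {n : ℕ} {S : Set V} (h : PathOn G a b n S) :
    PathOn G b a n S := by
  obtain ⟨p, hp, hn, hS⟩ := h
  exact ⟨p.reverse, hp.reverse, by simpa using hn, by simpa using hS⟩

theorem PathOn.append {a b x y : V} {n m : ℕ} {S T : Set V} (h : PathOn G a b n S)
    (h' : PathOn G x y m T) (hbx : G.Adj b x) (hST : Disjoint S T) :
    PathOn G a y (n + m) (S ∪ T) := by
  obtain ⟨p, hp, hn, rfl⟩ := h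
  obtain ⟨q, hq, hm, rfl⟩ := h'
  have hs : (p.append (.cons hbx q)).support = p.support ++ q.support := by
    simp [SimpleGraph.Walk.support_append]
  refine ⟨p.append (.cons hbx q), ?_, ?_, ?_⟩
  · rw [SimpleGraph.Walk.isPath_def, hs]
    refine List.Nodup.append hp.support_nodup hq.support_nodup ?_
    intro z hz hz'
    exact Set.disjoint_left.1 hST hz hz'
  · simp; omega
  · rw [hs]; ext; simp

theorem PathOn.mono {G' : SimpleGraph V} (hG : G ≤ G') {a b : V} {n : ℕ} {S : Set V}
    (h : PathOn G a b n S) : PathOn G' a b n S := by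
  obtain ⟨p, hp, hn, hS⟩ := h
  refine ⟨p.mapLe hG, (SimpleGraph.Walk.isPath_mapLe hG).2 hp, by simpa using hn, ?_⟩
  rw [SimpleGraph.Walk.support_mapLe_eq_support, hS]

theorem PathOn.one_le {a b : V} {n : ℕ} {S : Set V} (h : PathOn G a b n S) : 1 ≤ n := by
  obtain ⟨p, hp, hn, rfl⟩ := h
  omega

theorem PathOn.two_le {a b : V} {n : ℕ} {S : Set V} (h : PathOn G a b n S) (hab : a ≠ b) :
    2 ≤ n := by
  obtain ⟨p, hp, hn, rfl⟩ := h
  cases p with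
  | nil => exact absurd rfl hab
  | cons _ _ => simp at hn; omega

/-- A cycle with `n` vertices, encoded as an `n`-periodic map from the integers: `c (i + 1)` is the
successor of `c i`. The degenerate case `n = 2` of a single edge is allowed. -/
structure IsCyc (G : SimpleGraph V) (n : ℕ) (c : ℤ → V) : Prop where
  eq_iff : ∀ i j, c i = c j ↔ (n : ℤ) ∣ i - j
  adj : ∀ i, G.Adj (c i) (c (i + 1))

/-- The vertices `c i, …, c j` of a cyclic order. -/
def arc (c : ℤ → V) (i j : ℤ) : Set V := c '' Set.Icc i j

theorem mem_arc {c : ℤ → V} {i j : ℤ} {x : V} : x ∈ arc c i j ↔ ∃ m, (i ≤ m ∧ m ≤ j) ∧ c m = x :=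
  Iff.rfl

theorem arc_subset_range (c : ℤ → V) (i j : ℤ) : arc c i j ⊆ Set.range c := by
  rintro _ ⟨m, -, rfl⟩
  exact ⟨m, rfl⟩

namespace IsCyc

variable {n : ℕ} {c : ℤ → V}

theorem shift (h : IsCyc G n c) (k : ℤ) : IsCyc G n (fun i => c (i + k)) where
  eq_iff i j := by rw [h.eq_iff]; ring_nf
  adj i := by
    have := h.adj (i + k)
    rwa [show i + k + 1 = i + 1 + k by ring] at this

theorem reverse (h : IsCyc G n c) : IsCyc G n (fun i => c (-i)) where
  eq_iff i j := by
    rw [h.eq_iff, show -i - -j = -(i - j) by ring, dvd_neg]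
  adj i := by
    have := (h.adj (-(i + 1))).symm
    rwa [show -(i + 1) + 1 = -i by ring] at this

theorem mono {G' : SimpleGraph V} (hG : G ≤ G') (h : IsCyc G n c) : IsCyc G' n c :=
  ⟨h.eq_iff, fun i => hG (h.adj i)⟩

theorem add_period (h : IsCyc G n c) (i : ℤ) : c (i + n) = c i := by
  rw [h.eq_iff]; simp

theorem period (h : IsCyc G n c) : c n = c 0 := by
  simpa using h.add_period 0

theorem eq_add (h : IsCyc G n c) {i j : ℤ} (hij : c i = c j) (k : ℤ) : c (i + k) = c (j + k) := by
  rw [h.eq_iff] at *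
  simpa using hij

theorem eq_of_lt (h : IsCyc G n c) {i j : ℤ} (hij : c i = c j) (h1 : i - j < n) (h2 : j - i < n) :
    i = j := by
  rw [h.eq_iff] at hij
  have := Int.eq_zero_of_abs_lt_dvd hij (by rw [abs_lt]; constructor <;> omega)
  omega

theorem exists_mem_window (h : IsCyc G n c) (hn : 0 < n) (a i : ℤ) :
    ∃ m, a ≤ m ∧ m < a + n ∧ c m = c i := by
  refine ⟨a + (i - a) % n, ?_, ?_, ?_⟩
  · have := Int.emod_nonneg (i - a) (b := n) (by omega)
    omega
  · have := Int.emod_lt_of_pos (i - a) (b := n) (by omega)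
    omega
  · rw [h.eq_iff]
    have := Int.emod_add_mul_ediv (i - a) n
    exact ⟨-((i - a) / n), by linarith⟩

theorem disjoint_arc (h : IsCyc G n c) {i j i' j' : ℤ} (h1 : j < i') (h2 : j' < i + n) :
    Disjoint (arc c i j) (arc c i' j') := by
  rw [Set.disjoint_left]
  rintro _ ⟨m, ⟨hm1, hm2⟩, rfl⟩ ⟨m', ⟨hm1', hm2'⟩, he⟩
  have := h.eq_of_lt he (by omega) (by omega)
  omega

theorem pathOn_arc (h : IsCyc G n c) {i j : ℤ} (hij : i ≤ j) (hj : j < i + n) :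
    PathOn G (c i) (c j) (j - i + 1).toNat (arc c i j) := by
  induction j, hij using Int.leInduction with
  | base =>
    have : arc c i i = {c i} := by simp [arc]
    rw [this]
    simpa using PathOn.single (G := G) (c i)
  | succ j hij ih =>
    have h1 := (ih (by omega)).append (PathOn.single (c (j + 1))) (h.adj j) (by
      have := h.disjoint_arc (i := i) (j := j) (i' := j + 1) (j' := j + 1) (by omega) (by omega)
      simpa [arc] using this)
    have e1 : (j - i + 1).toNat + 1 = (j + 1 - i + 1).toNat := by omega
    have e2 : arc c i j ∪ {c (j + 1)} = arc c i (j + 1) := by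
      ext x
      simp only [Set.mem_union, mem_arc, Set.mem_singleton_iff]
      constructor
      · rintro (⟨m, hm, rfl⟩ | rfl)
        · exact ⟨m, by omega, rfl⟩
        · exact ⟨j + 1, by omega, rfl⟩
      · rintro ⟨m, hm, rfl⟩
        rcases (by omega : m ≤ j ∨ m = j + 1) with h' | rfl
        · exact Or.inl ⟨m, by omega, rfl⟩
        · exact Or.inr rfl
    rwa [e1, e2] at h1

/-- Rotation by `k` along a cyclic order, as a map on vertices. -/
theorem exists_rotate (h : IsCyc G n c) (k : ℤ) : ∃ f : V → V, ∀ m, f (c m) = c (m + k) := by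
  classical
  refine ⟨fun y => if hy : ∃ m, c m = y then c (hy.choose + k) else y, fun m => ?_⟩
  have hy : ∃ m', c m' = c m := ⟨m, rfl⟩
  simp only [hy, dif_pos]
  exact h.eq_add hy.choose_spec k

end IsCyc

/-- A path with adjacent ends closes up to a cycle. -/
theorem PathOn.exists_isCyc {a b : V} {n : ℕ} {S : Set V} (h : PathOn G a b n S)
    (hba : G.Adj b a) : ∃ d, IsCyc G n d ∧ Set.range d = S := by
  obtain ⟨p, hp, hn, rfl⟩ := h
  have hn0 : (0 : ℤ) < n := by omega
  have hlt : ∀ i : ℤ, (i % n).toNat ≤ p.length := fun i => by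
    have h1 := Int.emod_nonneg i hn0.ne'
    have h2 := Int.emod_lt_of_pos i hn0
    omega
  refine ⟨fun i => p.getVert (i % n).toNat, ⟨fun i j => ?_, fun i => ?_⟩, ?_⟩
  · constructor
    · intro he
      have := hp.getVert_injOn (hlt i) (hlt j) he
      have h1 := Int.emod_nonneg i hn0.ne'
      have h2 := Int.emod_nonneg j hn0.ne'
      exact (Int.modEq_iff_dvd (a := j) (b := i)).1 (show j % n = i % n by omega)
    · intro hd
      rw [show j % n = i % n from (Int.modEq_iff_dvd (a := j) (b := i)).2 hd]
  · have h1 := Int.emod_nonneg i hn0.ne'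
    have h2 := Int.emod_lt_of_pos i hn0
    rcases (by omega : i % n + 1 < n ∨ i % n + 1 = n) with h3 | h3
    · have : (i + 1) % n = i % n + 1 := by
        rw [← Int.emod_add_emod, Int.emod_eq_of_lt (by omega) h3]
      rw [this, show (i % n + 1).toNat = (i % n).toNat + 1 by omega]
      exact p.adj_getVert_succ (by omega)
    · have : (i + 1) % n = 0 := by
        rw [← Int.emod_add_emod, h3, Int.emod_self]
      rw [this, show (i % n).toNat = p.length by omega]
      simpa using hba
  · ext x
    simp only [Set.mem_range, Set.mem_ofPred_eq, SimpleGraph.Walk.mem_support_iff_exists_getVert]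
    constructor
    · rintro ⟨i, rfl⟩
      exact ⟨_, rfl, hlt i⟩
    · rintro ⟨m, rfl, hm⟩
      refine ⟨m, ?_⟩
      rw [Int.emod_eq_of_lt (by omega) (by omega)]
      simp

end Paths

section Ears

variable {V : Type*} {G : SimpleGraph V}

/-! ### Ears of a cycle -/

/-- No cycle of `G` has more than `l` vertices. -/
def CycleBound (G : SimpleGraph V) (l : ℕ) : Prop :=
  ∀ (a b : V) (n : ℕ) (S : Set V), PathOn G a b n S → G.Adj b a → 3 ≤ n → n ≤ l

/-- An ear of the cyclic order `d`: a path with `r` vertices, disjoint from the cycle, whose ends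
`e₁` and `e₂` are adjacent to the two distinct vertices `d 0` and `d k` respectively. -/
structure IsEar (G : SimpleGraph V) (n : ℕ) (d : ℤ → V) (k : ℤ) (r : ℕ) (e₁ e₂ : V) (T : Set V) :
    Prop where
  cyc : IsCyc G n d
  pos : 0 < k
  lt : k < n
  path : PathOn G e₁ e₂ r T
  left : G.Adj (d 0) e₁
  right : G.Adj e₂ (d k)
  notMem : ∀ i, d i ∉ T

namespace IsEar

variable {n r l : ℕ} {d : ℤ → V} {k : ℤ} {e₁ e₂ : V} {T : Set V}

/-- The same ear, seen from its other end. -/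
theorem swap (h : IsEar G n d k r e₁ e₂ T) :
    IsEar G n (fun i => d (i + k)) (n - k) r e₂ e₁ T where
  cyc := h.cyc.shift k
  pos := by have := h.lt; omega
  lt := by have := h.pos; omega
  path := h.path.reverse
  left := by simpa using h.right.symm
  right := by simpa [h.cyc.period] using h.left.symm
  notMem i := h.notMem _

theorem disjoint_arc (h : IsEar G n d k r e₁ e₂ T) (i j : ℤ) : Disjoint (arc d i j) T := by
  rw [Set.disjoint_left]
  rintro _ ⟨m, -, rfl⟩
  exact h.notMem m

/-- The path running from `d i` forward to `d k`, through the ear, and from `d n = d 0` backward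
to `d j`. -/
theorem pathOn (h : IsEar G n d k r e₁ e₂ T) {i j : ℤ} (hi : 1 ≤ i) (hik : i ≤ k)
    (hj : k < j) (hjn : j ≤ n) :
    PathOn G (d i) (d j) ((k - i + 1).toNat + r + (n - j + 1).toNat)
      (arc d i k ∪ T ∪ arc d j n) := by
  have := h.lt
  refine (((h.cyc.pathOn_arc hik (by omega)).append h.path.reverse h.right.symm
    (h.disjoint_arc i k)).append (h.cyc.pathOn_arc hjn (by omega)).reverse ?_ ?_)
  · rw [h.cyc.period]; exact h.left.symm
  · exact Disjoint.union_left (h.cyc.disjoint_arc (by omega) (by omega)) (h.disjoint_arc j n).symm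

theorem length_le_of_adj (h : IsEar G n d k r e₁ e₂ T) (hl : CycleBound G l) {i j : ℤ}
    (hi : 1 ≤ i) (hik : i ≤ k) (hj : k < j) (hjn : j ≤ n) (hadj : G.Adj (d i) (d j)) :
    n + r + 2 ≤ l + i + (j - k) := by
  have h1 := h.path.one_le
  have := hl _ _ _ _ (h.pathOn hi hik hj hjn) hadj.symm (by omega)
  omega

theorem not_adj (h : IsEar G n d k r e₁ e₂ T) (hl : CycleBound G l) (hr : l < n + r) :
    ¬ G.Adj (d 1) (d (k + 1)) := by
  intro hadj
  have h1 := h.pos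
  have h2 := h.lt
  have := h.length_le_of_adj hl le_rfl (by omega) (by omega) (by omega) hadj
  omega

theorem not_common_neighbor (h : IsEar G n d k r e₁ e₂ T) (hl : CycleBound G l)
    (hr : l < n + r) {o : V} (ho : o ∉ Set.range d) (hoT : o ∉ T) (h1 : G.Adj (d 1) o)
    (h2 : G.Adj (d (k + 1)) o) : False := by
  have h3 := h.pos
  have h4 := h.lt
  have h5 := h.path.one_le
  have := hl _ _ _ _ ((h.pathOn le_rfl (by omega) (by omega) (by omega)).append (.single o) h2
    (by
      simp only [Set.disjoint_singleton_right, Set.mem_union, not_or]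
      exact ⟨⟨fun h => ho (arc_subset_range _ _ _ h), hoT⟩,
        fun h => ho (arc_subset_range _ _ _ h)⟩)) h1.symm (by omega)
  omega

theorem length_le_of_cross (h : IsEar G n d k r e₁ e₂ T) (hl : CycleBound G l) {m m' : ℤ}
    (hm : 1 ≤ m) (hmm' : m < m') (hm' : m' ≤ k) (h1 : G.Adj (d m') (d 1))
    (h2 : G.Adj (d m) (d (k + 1))) : n + r + 1 ≤ l + (m' - m) := by
  have h3 := h.lt
  have h5 := h.path.one_le
  have p := (((h.cyc.pathOn_arc hm (by omega)).append
    (h.cyc.pathOn_arc (i := k + 1) (j := n) (by omega) (by omega)) h2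
      (h.cyc.disjoint_arc (by omega) (by omega))).append h.path (by
        rw [h.cyc.period]; exact h.left)
        (Disjoint.union_left (h.disjoint_arc _ _) (h.disjoint_arc _ _))).append
    (h.cyc.pathOn_arc hm' (by omega)).reverse h.right (by
      refine Disjoint.union_left (Disjoint.union_left ?_ ?_) (h.disjoint_arc _ _).symm
      · exact h.cyc.disjoint_arc (by omega) (by omega)
      · exact (h.cyc.disjoint_arc (by omega) (by omega)).symm)
  have := hl _ _ _ _ p h1 (by omega)
  omega

theorem not_cross (h : IsEar G n d k r e₁ e₂ T) (hl : CycleBound G l) (hr : l < n + r) {m : ℤ}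
    (hm : 1 ≤ m) (hm' : m + 1 ≤ k) (h1 : G.Adj (d (m + 1)) (d 1))
    (h2 : G.Adj (d m) (d (k + 1))) : False := by
  have := h.length_le_of_cross hl hm (by omega) hm' h1 h2
  omega

theorem not_cross_skip (h : IsEar G n d k r e₁ e₂ T) (hl : CycleBound G l) (hr : l + 1 < n + r)
    {m : ℤ} (hm : 1 ≤ m) (hm' : m + 2 ≤ k) (h1 : G.Adj (d (m + 2)) (d 1))
    (h2 : G.Adj (d m) (d (k + 1))) : False := by
  have := h.length_le_of_cross hl hm (by omega) hm' h1 h2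
  omega

theorem not_cross' (h : IsEar G n d k r e₁ e₂ T) (hl : CycleBound G l) (hr : l < n + r) {m : ℤ}
    (hm : k < m) (hm' : m + 1 ≤ n) (h1 : G.Adj (d m) (d 1))
    (h2 : G.Adj (d (m + 1)) (d (k + 1))) : False := by
  refine h.swap.not_cross hl hr (m := m - k) (by omega) (by omega) ?_ ?_
  · rwa [show m - k + 1 + k = m + 1 by ring, add_comm 1 k]
  · rwa [show m - k + k = m by ring, show (n - k + 1 + k : ℤ) = 1 + n by ring, h.cyc.add_period]

theorem not_cross_skip' (h : IsEar G n d k r e₁ e₂ T) (hl : CycleBound G l)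
    (hr : l + 1 < n + r) {m : ℤ} (hm : k < m) (hm' : m + 2 ≤ n) (h1 : G.Adj (d m) (d 1))
    (h2 : G.Adj (d (m + 2)) (d (k + 1))) : False := by
  refine h.swap.not_cross_skip hl hr (m := m - k) (by omega) (by omega) ?_ ?_
  · rwa [show m - k + 2 + k = m + 2 by ring, add_comm 1 k]
  · rwa [show m - k + k = m by ring, show (n - k + 1 + k : ℤ) = 1 + n by ring, h.cyc.add_period]

end IsEar

/-- A path outside a longest cycle cannot be inserted between two consecutive vertices. -/
theorem IsCyc.length_le_of_insert {n r l : ℕ} {d : ℤ → V} (h : IsCyc G n d)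
    (hl : CycleBound G l) {e₁ e₂ : V} {T : Set V} (hT : PathOn G e₁ e₂ r T)
    (hd : ∀ i, d i ∉ T) {i : ℤ} (h1 : G.Adj (d i) e₁) (h2 : G.Adj e₂ (d (i + 1))) (hn : 2 ≤ n) :
    n + r ≤ l := by
  have := hT.one_le
  have p := (h.pathOn_arc (i := i + 1) (j := i + n) (by omega) (by omega)).append hT (by
    rwa [h.add_period]) (by
      rw [Set.disjoint_left]
      rintro _ ⟨m, -, rfl⟩
      exact hd m)
  have := hl _ _ _ _ p h2 (by omega)
  omega

end Ears

section Distance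

variable {V : Type*} {G : SimpleGraph V}

/-! ### Balls and the degree condition -/

theorem mem_M_self (r : ℕ) (v : V) : v ∈ M G r v := by simp [M]

theorem mem_M_succ {r : ℕ} {v x y : V} (h : x ∈ M G r v) (hxy : G.Adj x y) :
    y ∈ M G (r + 1) v := by
  simp only [M, Set.mem_ofPred_eq] at *
  calc G.edist v y ≤ G.edist v x + G.edist x y := SimpleGraph.edist_triangle
    _ ≤ r + 1 := add_le_add h (by rw [SimpleGraph.edist_eq_one_iff_adj.2 hxy])
    _ = ((r + 1 : ℕ) : ℕ∞) := by simp

theorem M_mono {r s : ℕ} (hrs : r ≤ s) {v x : V} (h : x ∈ M G r v) : x ∈ M G s v := by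
  simp only [M, Set.mem_ofPred_eq] at *
  exact h.trans (by exact_mod_cast hrs)

theorem mem_M_one {v x : V} (h : G.Adj v x) : x ∈ M G 1 v := mem_M_succ (mem_M_self 0 v) h

theorem mem_M_two {v x y : V} (h : G.Adj v x) (h' : G.Adj x y) : y ∈ M G 2 v :=
  mem_M_succ (mem_M_one h) h'

theorem exists_center_of_mem_M_three {v x : V} (h : x ∈ M G 3 v) :
    ∃ w, v ∈ M G 1 w ∧ x ∈ M G 2 w := by
  simp only [M, Set.mem_ofPred_eq] at h
  obtain ⟨p, hp⟩ := SimpleGraph.exists_walk_of_edist_ne_top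
    (ne_top_of_le_ne_top (by exact WithTop.coe_ne_top) h)
  rw [← hp] at h
  have h : p.length ≤ 3 := by exact_mod_cast h
  cases p with
  | nil => exact ⟨v, mem_M_self _ _, mem_M_self _ _⟩
  | cons hvw q =>
    refine ⟨_, mem_M_one hvw.symm, ?_⟩
    simp only [SimpleGraph.Walk.length_cons] at h
    simp only [M, Set.mem_ofPred_eq]
    exact q.edist_le.trans (by exact_mod_cast (by omega : q.length ≤ 2))

/-- The degree condition of the theorem. -/
def TripleBound [Fintype V] (G : SimpleGraph V) [DecidableRel G.Adj] : Prop :=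
  ∀ v x y z : V, x ∈ M G 2 v → y ∈ M G 2 v →
      z ∈ M G 2 v → x ≠ y → y ≠ z → x ≠ z → G.IsIndepSet {x, y, z} →
      (M G 3 v).ncard + 2 ≤ G.degree x + G.degree y + G.degree z

/-- The degree condition fails as soon as the neighbourhoods of `x`, `y`, `z` can be replaced, at a
total loss of at most one element, by pairwise disjoint subsets of the ball of radius `3`. -/
theorem TripleBound.false_of_disjoint [Fintype V] [DecidableRel G.Adj] (hT : TripleBound G)
    {v x y z : V} (hx : x ∈ M G 2 v) (hy : y ∈ M G 2 v) (hz : z ∈ M G 2 v) (hxy : x ≠ y)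
    (hyz : y ≠ z) (hxz : x ≠ z) (hxy' : ¬ G.Adj x y) (hyz' : ¬ G.Adj y z) (hxz' : ¬ G.Adj x z)
    {S₁ S₂ S₃ : Finset V} (h₁ : ∀ u ∈ S₁, u ∈ M G 3 v) (h₂ : ∀ u ∈ S₂, u ∈ M G 3 v)
    (h₃ : ∀ u ∈ S₃, u ∈ M G 3 v) (h₁₂ : ∀ u ∈ S₁, u ∉ S₂) (h₁₃ : ∀ u ∈ S₁, u ∉ S₃)
    (h₂₃ : ∀ u ∈ S₂, u ∉ S₃)
    (hcard : G.degree x + G.degree y + G.degree z ≤ S₁.card + S₂.card + S₃.card + 1) : False := by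
  classical
  have hind : G.IsIndepSet {x, y, z} := by
    intro a ha b hb hab
    simp only [Set.mem_insert_iff, Set.mem_singleton_iff] at ha hb
    rcases ha with rfl | rfl | rfl <;> rcases hb with rfl | rfl | rfl <;>
      first | exact absurd rfl hab | assumption | (rw [G.adj_comm]; assumption)
  have h := hT v x y z hx hy hz hxy hyz hxz hind
  have hc : (S₁ ∪ S₂ ∪ S₃).card = S₁.card + S₂.card + S₃.card := by
    rw [Finset.card_union_of_disjoint, Finset.card_union_of_disjoint]
    · exact Finset.disjoint_left.2 fun u hu => h₁₂ u hu
    · refine Finset.disjoint_left.2 fun u hu => ?_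
      rcases Finset.mem_union.1 hu with hu | hu
      · exact h₁₃ u hu
      · exact h₂₃ u hu
  have hle : (S₁ ∪ S₂ ∪ S₃).card ≤ (M G 3 v).ncard := by
    rw [← Set.ncard_coe_finset]
    refine Set.ncard_le_ncard (fun u hu => ?_) (Set.toFinite _)
    simp only [Finset.coe_union, Set.mem_union, Finset.mem_coe] at hu
    rcases hu with (hu | hu) | hu
    · exact h₁ u hu
    · exact h₂ u hu
    · exact h₃ u hu
  omega

end Distance

section Attachments

variable {V : Type*} {G : SimpleGraph V}

/-! ### A component off a longest cycle -/

/-- The vertex `v` has a neighbour in `H`. -/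
def IsAtt (G : SimpleGraph V) (H : Set V) (v : V) : Prop := ∃ h ∈ H, G.Adj v h

/-- `c` is the cyclic order of a longest cycle, with `l` vertices, and `H` is the vertex set of a
component with at least one edge of what remains after deleting the cycle. -/
structure OffCycle (G : SimpleGraph V) (l : ℕ) (c : ℤ → V) (H : Set V) : Prop where
  bound : CycleBound G l
  three : 3 ≤ l
  cyc : IsCyc G l c
  notMem : ∀ i, c i ∉ H
  closed : ∀ x ∈ H, ∀ y, G.Adj x y → y ∈ H ∨ y ∈ Set.range c
  conn : ∀ x ∈ H, ∀ y ∈ H, ∃ n S, PathOn G x y n S ∧ S ⊆ H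
  nontriv : ∀ x ∈ H, ∃ y ∈ H, G.Adj x y

namespace OffCycle

variable {l : ℕ} {c : ℤ → V} {H : Set V}

theorem shift (K : OffCycle G l c H) (k : ℤ) : OffCycle G l (fun i => c (i + k)) H where
  bound := K.bound
  three := K.three
  cyc := K.cyc.shift k
  notMem i := K.notMem _
  closed x hx y hxy := by
    refine (K.closed x hx y hxy).imp id ?_
    rintro ⟨i, rfl⟩
    exact ⟨i - k, by simp⟩
  conn := K.conn
  nontriv := K.nontriv

theorem reverse (K : OffCycle G l c H) : OffCycle G l (fun i => c (-i)) H where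
  bound := K.bound
  three := K.three
  cyc := K.cyc.reverse
  notMem i := K.notMem _
  closed x hx y hxy := by
    refine (K.closed x hx y hxy).imp id ?_
    rintro ⟨i, rfl⟩
    exact ⟨-i, by simp⟩
  conn := K.conn
  nontriv := K.nontriv

theorem exists_eq_of_isAtt (K : OffCycle G l c H) {v : V} (hv : IsAtt G H v) (hvH : v ∉ H) :
    ∃ j, c j = v := by
  obtain ⟨h, hh, hvh⟩ := hv
  exact (K.closed h hh v hvh.symm).resolve_left hvH

theorem not_isAtt_succ (K : OffCycle G l c H) {i : ℤ} (hi : IsAtt G H (c i)) :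
    ¬ IsAtt G H (c (i + 1)) := by
  rintro ⟨y, hy, hiy⟩
  obtain ⟨x, hx, hix⟩ := hi
  obtain ⟨n, S, hS, hSH⟩ := K.conn x hx y hy
  have h1 := hS.one_le
  have h2 := K.three
  have := K.cyc.length_le_of_insert K.bound hS (fun i h => K.notMem i (hSH h)) hix hiy.symm
    (by omega)
  omega

theorem not_isAtt_pred (K : OffCycle G l c H) {i : ℤ} (hi : IsAtt G H (c i)) :
    ¬ IsAtt G H (c (i - 1)) := fun h => by
  have := K.not_isAtt_succ h
  rw [sub_add_cancel] at this
  exact this hi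

theorem exists_index (K : OffCycle G l c H) {i j : ℤ} (h : c i ≠ c j) :
    ∃ k : ℤ, 0 < k ∧ k < l ∧ c (k + i) = c j := by
  have := K.three
  obtain ⟨m, h1, h2, h3⟩ := K.cyc.exists_mem_window (by omega) i j
  have h4 : m ≠ i := by
    rintro rfl
    exact h h3
  exact ⟨m - i, by omega, by omega, by simpa using h3⟩

theorem exists_isEar (K : OffCycle G l c H) {k : ℤ} (hk : 0 < k) (hkl : k < l) {x y : V}
    (hx : x ∈ H) (hy : y ∈ H) (h0 : G.Adj (c 0) x) (hky : G.Adj (c k) y) :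
    ∃ r T, IsEar G l c k r x y T ∧ T ⊆ H ∧ 1 ≤ r ∧ (x ≠ y → 2 ≤ r) := by
  obtain ⟨n, S, hS, hSH⟩ := K.conn x hx y hy
  exact ⟨n, S, ⟨K.cyc, hk, hkl, hS, h0, hky.symm, fun i h => K.notMem i (hSH h)⟩, hSH, hS.one_le,
    fun h => hS.two_le h⟩

theorem succ_not_adj_succ (K : OffCycle G l c H) {i j : ℤ} (hi : IsAtt G H (c i))
    (hj : IsAtt G H (c j)) (hij : c i ≠ c j) : ¬ G.Adj (c (i + 1)) (c (j + 1)) := by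
  obtain ⟨k, hk, hkl, hkj⟩ := K.exists_index hij
  obtain ⟨x, hx, hix⟩ := hi
  obtain ⟨y, hy, hjy⟩ := hj
  obtain ⟨r, T, hE, -, hr, -⟩ := (K.shift i).exists_isEar hk hkl hx hy (by simpa using hix)
    (by simpa only [hkj] using hjy)
  have h := hE.not_adj K.bound (by omega)
  have e := K.cyc.eq_add hkj 1
  rw [← e]
  rwa [add_comm 1 i, show k + 1 + i = k + i + 1 by ring] at h

end OffCycle

/-- Bondy's count around an ear: `v₁ = c 0` and `v₂ = c k` are joined by an ear through `H`, and
`z` is a third vertex, in `H`. On the arc from `c 1` to `c k` the neighbours of `c 1` are moved one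
step back, on the arc from `c (k + 1)` to `c l` those of `c (k + 1)` are; the neighbours of `z`
other than `v₁` and `v₂` stay in place unless they collide, in which case they move one step
forward. All these moves stay within the ball of radius `3`, since both `c 1` and `c (k + 1)` are
adjacent to its centre. -/
theorem OffCycle.bondy_count [Fintype V] [DecidableRel G.Adj] {l r : ℕ} {c : ℤ → V} {H : Set V}
    (K : OffCycle G l c H) (hT : TripleBound G) {k : ℤ} {e₁ e₂ z w : V} {T : Set V}
    (hE : IsEar G l c k r e₁ e₂ T) (hTH : T ⊆ H) (he₁ : e₁ ∈ H) (he₂ : e₂ ∈ H) (hz : z ∈ H)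
    (h1 : G.Adj w (c 1)) (h2 : G.Adj w (c (k + 1))) (hzw : z ∈ M G 2 w)
    (hskip : ∀ m, 1 ≤ m → m + 2 ≤ k → G.Adj z (c m) → G.Adj (c m) (c (k + 1)) →
      ¬ G.Adj (c (m + 2)) (c 1))
    (hskip' : ∀ m, k < m → m + 2 ≤ l → G.Adj z (c m) → G.Adj (c m) (c 1) →
      ¬ G.Adj (c (m + 2)) (c (k + 1))) : False := by
  classical
  have hk0 := hE.pos
  have hkl := hE.lt
  have hr := hE.path.one_le
  have hr' : l < l + r := by omega
  have ha0 : IsAtt G H (c 0) := ⟨e₁, he₁, hE.left⟩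
  have hak : IsAtt G H (c k) := ⟨e₂, he₂, hE.right.symm⟩
  have hp : ¬ IsAtt G H (c 1) := by simpa using K.not_isAtt_succ ha0
  have hq : ¬ IsAtt G H (c (k + 1)) := K.not_isAtt_succ hak
  obtain ⟨pr, hpr⟩ := K.cyc.exists_rotate (-1)
  obtain ⟨su, hsu⟩ := K.cyc.exists_rotate 1
  have hcases : ∀ y, (∃ m, 1 ≤ m ∧ m ≤ k ∧ c m = y) ∨ (∃ m, k < m ∧ m ≤ l ∧ c m = y) ∨
      y ∉ Set.range c := by
    intro y
    by_cases hy : y ∈ Set.range c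
    · obtain ⟨i, rfl⟩ := hy
      obtain ⟨m, hm1, hm2, hm⟩ := K.cyc.exists_mem_window (by omega) 1 i
      rcases le_or_gt m k with h | h
      · exact Or.inl ⟨m, hm1, h, hm⟩
      · exact Or.inr (Or.inl ⟨m, by omega, by omega, hm⟩)
    · exact Or.inr (Or.inr hy)
  have hwin : ∀ m m' : ℤ, 1 ≤ m → m ≤ l → 1 ≤ m' → m' ≤ l → c m = c m' → m = m' :=
    fun m m' _ _ _ _ h => K.cyc.eq_of_lt h (by omega) (by omega)
  have hI : ∀ m : ℤ, 1 ≤ m → m ≤ l → (c m ∈ arc c 1 k ↔ m ≤ k) := by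
    intro m hm hml
    refine ⟨?_, fun h => ⟨m, ⟨hm, h⟩, rfl⟩⟩
    rintro ⟨m', ⟨hm1, hm2⟩, h⟩
    have := hwin m' m (by omega) (by omega) hm hml h
    omega
  have hoffI : ∀ y, y ∉ Set.range c → y ∉ arc c 1 k := fun y hy h => hy (arc_subset_range _ _ _ h)
  let fA : V → V := fun y => if y ∈ arc c 1 k then pr y else y
  let fB : V → V := fun y => if y ∈ arc c 1 k ∨ y ∉ Set.range c then y else pr y
  let fZ : V → V := fun y => if (y ∈ arc c 1 k ∧ G.Adj y (c (k + 1))) ∨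
    (y ∈ Set.range c ∧ y ∉ arc c 1 k ∧ G.Adj y (c 1)) then su y else y
  have hA : ∀ y, G.Adj (c 1) y → (∃ m, 1 ≤ m ∧ m + 1 ≤ k ∧ c (m + 1) = y ∧ fA y = c m) ∨
      (∃ m, k < m ∧ m ≤ l ∧ c m = y ∧ fA y = c m) ∨ (y ∉ Set.range c ∧ fA y = y) := by
    intro y hy
    rcases hcases y with ⟨m, h3, h4, rfl⟩ | ⟨m, h3, h4, rfl⟩ | h3
    · refine Or.inl ⟨m - 1, ?_, by omega, by simp, ?_⟩
      · have : m ≠ 1 := by rintro rfl; exact hy.ne rfl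
        omega
      · simp [fA, hI m h3 (by omega), h4, hpr, sub_eq_add_neg]
    · refine Or.inr (Or.inl ⟨m, h3, h4, rfl, ?_⟩)
      simp [fA, hI m (by omega) h4, not_le.2 h3]
    · exact Or.inr (Or.inr ⟨h3, by simp [fA, hoffI y h3]⟩)
  have hB : ∀ y, G.Adj (c (k + 1)) y → (∃ m, 1 ≤ m ∧ m ≤ k ∧ c m = y ∧ fB y = c m) ∨
      (∃ m, k < m ∧ m + 1 ≤ l ∧ c (m + 1) = y ∧ fB y = c m) ∨ (y ∉ Set.range c ∧ fB y = y) := by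
    intro y hy
    rcases hcases y with ⟨m, h3, h4, rfl⟩ | ⟨m, h3, h4, rfl⟩ | h3
    · refine Or.inl ⟨m, h3, h4, rfl, ?_⟩
      simp [fB, hI m h3 (by omega), h4]
    · refine Or.inr (Or.inl ⟨m - 1, ?_, by omega, by simp, ?_⟩)
      · have : m ≠ k + 1 := by rintro rfl; exact hy.ne rfl
        omega
      · simp [fB, hI m (by omega) h4, not_le.2 h3, hpr, sub_eq_add_neg]
    · exact Or.inr (Or.inr ⟨h3, by simp only [fB, h3, not_false_eq_true, or_true, if_true]⟩)
  have hZ : ∀ y, (y = z ∨ G.Adj z y) → y ≠ c 0 → y ≠ c k →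
      (∃ m, 1 ≤ m ∧ m + 1 ≤ k ∧ c m = y ∧ G.Adj z (c m) ∧ G.Adj (c m) (c (k + 1)) ∧
        fZ y = c (m + 1)) ∨
      (∃ m, 1 ≤ m ∧ m + 1 ≤ k ∧ c m = y ∧ G.Adj z (c m) ∧ ¬ G.Adj (c m) (c (k + 1)) ∧
        fZ y = c m) ∨
      (∃ m, k < m ∧ m + 1 ≤ l ∧ c m = y ∧ G.Adj z (c m) ∧ G.Adj (c m) (c 1) ∧
        fZ y = c (m + 1)) ∨
      (∃ m, k < m ∧ m + 1 ≤ l ∧ c m = y ∧ G.Adj z (c m) ∧ ¬ G.Adj (c m) (c 1) ∧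
        fZ y = c m) ∨ (y ∈ H ∧ fZ y = y) := by
    intro y hy hy0 hyk
    by_cases hyH : y ∈ H
    · have h3 : y ∉ Set.range c := by rintro ⟨i, rfl⟩; exact K.notMem i hyH
      refine Or.inr (Or.inr (Or.inr (Or.inr ⟨hyH, ?_⟩)))
      simp only [fZ, h3, hoffI y h3, false_and, or_self, if_false]
    · have hzy : G.Adj z y := hy.resolve_left (by rintro rfl; exact hyH hz)
      have hyr := (K.closed z hz y hzy).resolve_left hyH
      rcases hcases y with ⟨m, h3, h4, rfl⟩ | ⟨m, h3, h4, rfl⟩ | h3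
      · have hmk : m ≠ k := by rintro rfl; exact hyk rfl
        by_cases h5 : G.Adj (c m) (c (k + 1))
        · refine Or.inl ⟨m, h3, by omega, rfl, hzy, h5, ?_⟩
          simp [fZ, hI m h3 (by omega), h4, h5, hsu]
        · refine Or.inr (Or.inl ⟨m, h3, by omega, rfl, hzy, h5, ?_⟩)
          simp [fZ, hI m h3 (by omega), h4, h5]
      · have hml : m ≠ l := by rintro rfl; exact hy0 K.cyc.period
        by_cases h5 : G.Adj (c m) (c 1)
        · refine Or.inr (Or.inr (Or.inl ⟨m, h3, by omega, rfl, hzy, h5, ?_⟩))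
          simp [fZ, hI m (by omega) h4, not_le.2 h3, h5, hsu]
        · refine Or.inr (Or.inr (Or.inr (Or.inl ⟨m, h3, by omega, rfl, hzy, h5, ?_⟩)))
          simp [fZ, hI m (by omega) h4, not_le.2 h3, h5]
      · exact absurd hyr h3
  -- Successors of attachments are neither attachments nor adjacent to `c 1` or `c (k + 1)`.
  have hZsucc : ∀ m : ℤ, 1 ≤ m → m ≤ l → G.Adj z (c m) → ¬ G.Adj z (c (m + 1)) := fun m _ _ h h' =>
    K.not_isAtt_succ ⟨z, hz, h.symm⟩ ⟨z, hz, h'.symm⟩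
  have hZ1 : ∀ m : ℤ, 1 ≤ m → m < l → G.Adj z (c m) → ¬ G.Adj (c (m + 1)) (c 1) := by
    intro m hm hml h
    have := K.succ_not_adj_succ (i := m) (j := 0) ⟨z, hz, h.symm⟩ ha0 (fun h => by
      have := K.cyc.eq_of_lt h (by omega) (by omega); omega)
    simpa using this
  have hZk : ∀ m : ℤ, 1 ≤ m → m ≤ l → m ≠ k → G.Adj z (c m) → ¬ G.Adj (c (m + 1)) (c (k + 1)) := by
    intro m hm hml hmk h
    exact K.succ_not_adj_succ (i := m) (j := k) ⟨z, hz, h.symm⟩ hak (fun h => by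
      have := hwin m k hm hml (by omega) (by omega) h; omega)
  have hpH : ∀ y, G.Adj (c 1) y → y ∉ H := fun y h h' => hp ⟨y, h', h⟩
  have hqH : ∀ y, G.Adj (c (k + 1)) y → y ∉ H := fun y h h' => hq ⟨y, h', h⟩
  have hHr : ∀ y, y ∈ H → y ∉ Set.range c := by rintro _ h ⟨i, rfl⟩; exact K.notMem i h
  have hcross : ∀ m : ℤ, 1 ≤ m → m + 1 ≤ k → G.Adj (c 1) (c (m + 1)) → ¬ G.Adj (c (k + 1)) (c m) :=
    fun m h3 h4 h5 h6 => hE.not_cross K.bound hr' h3 h4 h5.symm h6.symm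
  have hcross' : ∀ m : ℤ, k < m → m + 1 ≤ l → G.Adj (c 1) (c m) → ¬ G.Adj (c (k + 1)) (c (m + 1)) :=
    fun m h3 h4 h5 h6 => hE.not_cross' K.bound hr' h3 h4 h5.symm h6.symm
  have hcommon : ∀ o, o ∉ Set.range c → G.Adj (c 1) o → ¬ G.Adj (c (k + 1)) o :=
    fun o h3 h4 h5 => hE.not_common_neighbor K.bound hr' h3 (fun h => hpH o h4 (hTH h)) h4 h5
  have hcomp : ∀ m m' : ℤ, 1 ≤ m → m ≤ l → 1 ≤ m' → m' ≤ l → m ≠ m' → c m ≠ c m' :=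
    fun m m' h3 h4 h5 h6 h7 h8 => h7 (hwin m m' h3 h4 h5 h6 h8)
  have hinjA : Set.InjOn fA (G.neighborFinset (c 1)) := by
    intro y hy y' hy' he
    simp only [Finset.mem_coe, SimpleGraph.mem_neighborFinset] at hy hy'
    rcases hA y hy with ⟨m, h3, h4, h5, h6⟩ | ⟨m, h3, h4, h5, h6⟩ | ⟨h5, h6⟩ <;>
    rcases hA y' hy' with ⟨m', h3', h4', h5', h6'⟩ | ⟨m', h3', h4', h5', h6'⟩ | ⟨h5', h6'⟩ <;>
    rw [h6, h6'] at he <;>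
    first
      | exact he
      | exact absurd ⟨_, he⟩ h5'
      | exact absurd ⟨_, he.symm⟩ h5
      | (have := hwin m m' (by omega) (by omega) (by omega) (by omega) he
         first | (subst this; exact h5.symm.trans h5') | omega)
  have hinjB : Set.InjOn fB (G.neighborFinset (c (k + 1))) := by
    intro y hy y' hy' he
    simp only [Finset.mem_coe, SimpleGraph.mem_neighborFinset] at hy hy'
    rcases hB y hy with ⟨m, h3, h4, h5, h6⟩ | ⟨m, h3, h4, h5, h6⟩ | ⟨h5, h6⟩ <;>
    rcases hB y' hy' with ⟨m', h3', h4', h5', h6'⟩ | ⟨m', h3', h4', h5', h6'⟩ | ⟨h5', h6'⟩ <;>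
    rw [h6, h6'] at he <;>
    first
      | exact he
      | exact absurd ⟨_, he⟩ h5'
      | exact absurd ⟨_, he.symm⟩ h5
      | (have := hwin m m' (by omega) (by omega) (by omega) (by omega) he
         first | (subst this; exact h5.symm.trans h5') | omega)
  set Z : Finset V := insert z (G.neighborFinset z) \ {c 0, c k} with hZdef
  have hmemZ : ∀ y, y ∈ Z → (y = z ∨ G.Adj z y) ∧ y ≠ c 0 ∧ y ≠ c k := by
    intro y hy
    simpa [hZdef, not_or] using hy
  have hcardZ : G.degree z ≤ Z.card + 1 := by
    have h3 : _ ≤ Z.card := Finset.le_card_sdiff {c 0, c k} (insert z (G.neighborFinset z))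
    rw [Finset.card_insert_of_notMem (by simp), SimpleGraph.card_neighborFinset_eq_degree] at h3
    have h4 : ({c 0, c k} : Finset V).card ≤ 2 := Finset.card_le_two
    omega
  have hinjZ : Set.InjOn fZ Z := by
    intro y hy y' hy' he
    obtain ⟨hy1, hy2, hy3⟩ := hmemZ y hy
    obtain ⟨hy1', hy2', hy3'⟩ := hmemZ y' hy'
    rcases hZ y hy1 hy2 hy3 with ⟨m, h3, h4, h5, h6, h7, h8⟩ | ⟨m, h3, h4, h5, h6, h7, h8⟩ |
      ⟨m, h3, h4, h5, h6, h7, h8⟩ | ⟨m, h3, h4, h5, h6, h7, h8⟩ | ⟨h5, h8⟩ <;>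
    rcases hZ y' hy1' hy2' hy3' with ⟨m', h3', h4', h5', h6', h7', h8'⟩ |
      ⟨m', h3', h4', h5', h6', h7', h8'⟩ | ⟨m', h3', h4', h5', h6', h7', h8'⟩ |
      ⟨m', h3', h4', h5', h6', h7', h8'⟩ | ⟨h5', h8'⟩ <;>
    rw [h8, h8'] at he <;>
    first
      | exact he
      | exact absurd ⟨_, he⟩ (hHr _ h5')
      | exact absurd ⟨_, he.symm⟩ (hHr _ h5)
      | (have := hwin _ _ (by omega) (by omega) (by omega) (by omega) he
         first
           | omega
           | (subst this; exact h5.symm.trans h5')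
           | (subst this; exact absurd h6' (hZsucc m (by omega) (by omega) h6))
           | (subst this; exact absurd h6 (hZsucc m' (by omega) (by omega) h6'))
           | (obtain rfl : m = m' := by omega
              exact h5.symm.trans h5'))
  have hAB : ∀ u ∈ (G.neighborFinset (c 1)).image fA,
      u ∉ (G.neighborFinset (c (k + 1))).image fB := by
    intro u hu hu'
    simp only [Finset.mem_image, SimpleGraph.mem_neighborFinset] at hu hu'
    obtain ⟨y, hy, he⟩ := hu
    obtain ⟨y', hy', rfl⟩ := hu'
    rcases hA y hy with ⟨m, h3, h4, h5, h6⟩ | ⟨m, h3, h4, h5, h6⟩ | ⟨h5, h6⟩ <;>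
    rcases hB y' hy' with ⟨m', h3', h4', h5', h6'⟩ | ⟨m', h3', h4', h5', h6'⟩ | ⟨h5', h6'⟩ <;>
    rw [h6, h6'] at he <;>
    first
      | (subst he; exact hcommon _ h5 hy hy')
      | exact absurd ⟨_, he⟩ h5'
      | exact absurd ⟨_, he.symm⟩ h5
      | (have := hwin m m' (by omega) (by omega) (by omega) (by omega) he
         first
           | omega
           | (subst this; subst h5; subst h5'
              first
                | exact hcross m h3 h4 hy hy'
                | exact hcross' m h3 h4' hy hy'))
  have hAZ : ∀ u ∈ (G.neighborFinset (c 1)).image fA, u ∉ Z.image fZ := by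
    intro u hu hu'
    simp only [Finset.mem_image, SimpleGraph.mem_neighborFinset] at hu hu'
    obtain ⟨y, hy, he⟩ := hu
    obtain ⟨y', hy', rfl⟩ := hu'
    obtain ⟨hy1', hy2', hy3'⟩ := hmemZ y' hy'
    rcases hA y hy with ⟨m, h3, h4, h5, h6⟩ | ⟨m, h3, h4, h5, h6⟩ | ⟨h5, h6⟩ <;>
    rcases hZ y' hy1' hy2' hy3' with ⟨m', h3', h4', h5', h6', h7', h8'⟩ |
      ⟨m', h3', h4', h5', h6', h7', h8'⟩ | ⟨m', h3', h4', h5', h6', h7', h8'⟩ |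
      ⟨m', h3', h4', h5', h6', h7', h8'⟩ | ⟨h5', h8'⟩ <;>
    rw [h6, h8'] at he <;>
    first
      | (subst he; exact hpH _ hy h5')
      | exact absurd ⟨_, he⟩ (hHr _ h5')
      | exact absurd ⟨_, he.symm⟩ h5
      | (have := hwin _ _ (by omega) (by omega) (by omega) (by omega) he
         first
           | omega
           | (subst h5; subst this
              first
                | exact hZ1 m (by omega) (by omega) h6' hy.symm
                | exact hZ1 m' (by omega) (by omega) h6' hy.symm
                | exact h7' hy.symm
                | (rw [add_assoc] at hy
                   exact hskip m' h3' (by omega) h6' h7' hy.symm)))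
  have hBZ : ∀ u ∈ (G.neighborFinset (c (k + 1))).image fB, u ∉ Z.image fZ := by
    intro u hu hu'
    simp only [Finset.mem_image, SimpleGraph.mem_neighborFinset] at hu hu'
    obtain ⟨y, hy, he⟩ := hu
    obtain ⟨y', hy', rfl⟩ := hu'
    obtain ⟨hy1', hy2', hy3'⟩ := hmemZ y' hy'
    rcases hB y hy with ⟨m, h3, h4, h5, h6⟩ | ⟨m, h3, h4, h5, h6⟩ | ⟨h5, h6⟩ <;>
    rcases hZ y' hy1' hy2' hy3' with ⟨m', h3', h4', h5', h6', h7', h8'⟩ |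
      ⟨m', h3', h4', h5', h6', h7', h8'⟩ | ⟨m', h3', h4', h5', h6', h7', h8'⟩ |
      ⟨m', h3', h4', h5', h6', h7', h8'⟩ | ⟨h5', h8'⟩ <;>
    rw [h6, h8'] at he <;>
    first
      | (subst he; exact hqH _ hy h5')
      | exact absurd ⟨_, he⟩ (hHr _ h5')
      | exact absurd ⟨_, he.symm⟩ h5
      | (have := hwin _ _ (by omega) (by omega) (by omega) (by omega) he
         first
           | omega
           | (subst h5; subst this
              first
                | exact hZk m (by omega) (by omega) (by omega) h6' hy.symm
                | exact hZk m' (by omega) (by omega) (by omega) h6' hy.symm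
                | exact h7' hy.symm
                | (rw [add_assoc] at hy
                   exact hskip' m' h3' (by omega) h6' h7' hy.symm)))
  have hstep : ∀ m : ℤ, c m ∈ M G 2 w → c (m - 1) ∈ M G 3 w ∧ c (m + 1) ∈ M G 3 w := by
    intro m hm
    refine ⟨mem_M_succ hm ?_, mem_M_succ hm (K.cyc.adj m)⟩
    have := K.cyc.adj (m - 1)
    rw [sub_add_cancel] at this
    exact this.symm
  have hMA : ∀ u ∈ (G.neighborFinset (c 1)).image fA, u ∈ M G 3 w := by
    intro u hu
    simp only [Finset.mem_image, SimpleGraph.mem_neighborFinset] at hu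
    obtain ⟨y, hy, rfl⟩ := hu
    have hy2 := mem_M_two h1 hy
    rcases hA y hy with ⟨m, h3, h4, rfl, h6⟩ | ⟨m, h3, h4, rfl, h6⟩ | ⟨h5, h6⟩ <;> rw [h6]
    · simpa using (hstep _ hy2).1
    · exact M_mono (by omega) hy2
    · exact M_mono (by omega) hy2
  have hMB : ∀ u ∈ (G.neighborFinset (c (k + 1))).image fB, u ∈ M G 3 w := by
    intro u hu
    simp only [Finset.mem_image, SimpleGraph.mem_neighborFinset] at hu
    obtain ⟨y, hy, rfl⟩ := hu
    have hy2 := mem_M_two h2 hy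
    rcases hB y hy with ⟨m, h3, h4, rfl, h6⟩ | ⟨m, h3, h4, rfl, h6⟩ | ⟨h5, h6⟩ <;> rw [h6]
    · exact M_mono (by omega) hy2
    · simpa using (hstep _ hy2).1
    · exact M_mono (by omega) hy2
  have hMZ : ∀ u ∈ Z.image fZ, u ∈ M G 3 w := by
    intro u hu
    simp only [Finset.mem_image] at hu
    obtain ⟨y, hy, rfl⟩ := hu
    obtain ⟨hy1, hy2, hy3⟩ := hmemZ y hy
    rcases hZ y hy1 hy2 hy3 with ⟨m, h3, h4, h5, h6, h7, h8⟩ | ⟨m, h3, h4, h5, h6, h7, h8⟩ |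
      ⟨m, h3, h4, h5, h6, h7, h8⟩ | ⟨m, h3, h4, h5, h6, h7, h8⟩ | ⟨h5, h8⟩ <;> rw [h8]
    · exact (hstep m (mem_M_two h2 h7.symm)).2
    · exact mem_M_succ hzw h6
    · exact (hstep m (mem_M_two h1 h7.symm)).2
    · exact mem_M_succ hzw h6
    · rcases hy1 with rfl | hy1
      · exact M_mono (by omega) hzw
      · exact mem_M_succ hzw hy1
  refine hT.false_of_disjoint (x := c 1) (y := c (k + 1)) (z := z)
    (M_mono (by omega) (mem_M_one h1)) (M_mono (by omega) (mem_M_one h2)) hzw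
    (hcomp _ _ (by omega) (by omega) (by omega) (by omega) (by omega))
    (fun h => K.notMem _ (h ▸ hz)) (fun h => K.notMem _ (h ▸ hz)) (hE.not_adj K.bound hr')
    (fun h => hqH _ h hz) (fun h => hpH _ h hz) hMA hMB hMZ hAB hAZ hBZ ?_
  rw [Finset.card_image_of_injOn hinjA, Finset.card_image_of_injOn hinjB,
    Finset.card_image_of_injOn hinjZ, SimpleGraph.card_neighborFinset_eq_degree,
    SimpleGraph.card_neighborFinset_eq_degree]
  omega

end Attachments

section Neighbors

variable {V : Type*} [Fintype V] {G : SimpleGraph V} [DecidableRel G.Adj]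

/-! ### Neighbours of attachments -/

/-- If the attachments `c i` and `c j` have distinct neighbours in `H`, they are joined by an ear
with at least two vertices, and Bondy's count applies at the centre `c j`. -/
theorem OffCycle.succ_not_adj_of_ne {l : ℕ} {c : ℤ → V} {H : Set V} (K : OffCycle G l c H)
    (hT : TripleBound G) {i j : ℤ} {x y : V} (hx : x ∈ H) (hy : y ∈ H) (hix : G.Adj (c i) x)
    (hjy : G.Adj (c j) y) (hxy : x ≠ y) (hij : c i ≠ c j) : ¬ G.Adj (c (i + 1)) (c j) := by
  intro hadj
  obtain ⟨k, hk, hkl, hkj⟩ := K.exists_index hij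
  obtain ⟨r, T, hE, hTH, -, hr⟩ := (K.shift i).exists_isEar hk hkl hx hy (by simpa using hix)
    (by simpa only [hkj] using hjy)
  have hr := hr hxy
  refine (K.shift i).bondy_count hT (w := c j) hE hTH hx hy hy ?_ ?_
    (M_mono (by omega) (mem_M_one hjy)) ?_ ?_
  · rw [add_comm 1 i]; exact hadj.symm
  · rw [show k + 1 + i = k + i + 1 by ring, ← hkj]; exact K.cyc.adj _
  · exact fun m h1 h2 _ h3 h4 => hE.not_cross_skip K.bound (by omega) h1 h2 h4 h3
  · exact fun m h1 h2 _ h3 h4 => hE.not_cross_skip' K.bound (by omega) h1 h2 h3 h4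

/-- The successor of an attachment is not adjacent to any other attachment. If all neighbours of
`c i` and `c j` in `H` coincide with one vertex `x`, the third vertex of Bondy's count is a
neighbour of `x` in `H`, for which no collision occurs by `succ_not_adj_of_ne`. -/
theorem OffCycle.succ_not_adj {l : ℕ} {c : ℤ → V} {H : Set V} (K : OffCycle G l c H)
    (hT : TripleBound G) {i j : ℤ} (hi : IsAtt G H (c i)) (hj : IsAtt G H (c j))
    (hij : c i ≠ c j) : ¬ G.Adj (c (i + 1)) (c j) := by
  intro hadj
  obtain ⟨x, hx, hix⟩ := hi
  obtain ⟨y, hy, hjy⟩ := hj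
  have huniq : ∀ x' ∈ H, ∀ y' ∈ H, G.Adj (c i) x' → G.Adj (c j) y' → x' = y' := by
    intro x' hx' y' hy' h1 h2
    by_contra hne
    exact K.succ_not_adj_of_ne hT hx' hy' h1 h2 hne hij hadj
  obtain rfl := huniq x hx y hy hix hjy
  obtain ⟨z, hz, hxz⟩ := K.nontriv x hx
  obtain ⟨k, hk, hkl, hkj⟩ := K.exists_index hij
  obtain ⟨r, T, hE, hTH, -, -⟩ := (K.shift i).exists_isEar hk hkl hx hy (by simpa using hix)
    (by simpa only [hkj] using hjy)
  have hkj' := K.cyc.eq_add hkj 1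
  refine (K.shift i).bondy_count hT (w := c j) hE hTH hx hy hz ?_ ?_ (mem_M_two hjy hxz) ?_ ?_
  · rw [add_comm 1 i]; exact hadj.symm
  · rw [show k + 1 + i = k + i + 1 by ring, ← hkj]; exact K.cyc.adj _
  · intro m h1 h2 h3 h4
    refine absurd h4.symm ?_
    rw [show k + 1 + i = k + i + 1 by ring, hkj']
    refine K.succ_not_adj_of_ne hT hx hz hjy h3.symm hxz.ne fun h => ?_
    rw [← h] at h3
    exact hxz.ne (huniq x hx z hz hix h3.symm)
  · intro m h1 h2 h3 h4
    refine absurd h4.symm ?_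
    rw [add_comm 1 i]
    refine K.succ_not_adj_of_ne hT hx hz hix h3.symm hxz.ne fun h => ?_
    rw [← h] at h3
    exact hxz.ne (huniq z hz x hx h3.symm hjy).symm

theorem OffCycle.pred_not_adj {l : ℕ} {c : ℤ → V} {H : Set V} (K : OffCycle G l c H)
    (hT : TripleBound G) {i j : ℤ} (hi : IsAtt G H (c i)) (hj : IsAtt G H (c j))
    (hij : c i ≠ c j) : ¬ G.Adj (c (i - 1)) (c j) := by
  have := K.reverse.succ_not_adj hT (i := -i) (j := -j) (by simpa using hi) (by simpa using hj)
    (by simpa using hij)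
  simpa [show -(-i + 1) = i - 1 by ring] using this

end Neighbors

section Bypass

variable {V : Type*} {G : SimpleGraph V}

/-! ### Bypassing an attachment -/

/-- The edge `xy` runs along the cyclic order `c`, or one of its ends is a cyclic neighbour of
`c 0`. -/
def BypassEdge (c : ℤ → V) (x y : V) : Prop :=
  (∃ j, (x = c j ∧ y = c (j + 1)) ∨ (x = c (j + 1) ∧ y = c j)) ∨
    (x = c 1 ∨ x = c (-1)) ∨ (y = c 1 ∨ y = c (-1))

/-- The cyclic order `d` of a cycle which avoids `c 0` and `H`, passes through all other vertices
of the cycle `c`, and uses edges of `c` except at the two cyclic neighbours of `c 0`. -/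
structure IsBypass (G : SimpleGraph V) (l : ℕ) (c : ℤ → V) (H : Set V) (n : ℕ) (d : ℤ → V) :
    Prop where
  cyc : IsCyc G n d
  len : l ≤ n + 1
  cover : ∀ j, c j ≠ c 0 → c j ∈ Set.range d
  avoid : ∀ m, d m ≠ c 0
  notMem : ∀ m, d m ∉ H
  edge : ∀ m, BypassEdge c (d m) (d (m + 1))

theorem IsBypass.shift {l n : ℕ} {c d : ℤ → V} {H : Set V} (h : IsBypass G l c H n d) (k : ℤ) :
    IsBypass G l c H n (fun i => d (i + k)) where
  cyc := h.cyc.shift k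
  len := h.len
  cover j hj := by
    obtain ⟨i, hi⟩ := h.cover j hj
    exact ⟨i - k, by simpa using hi⟩
  avoid m := h.avoid _
  notMem m := h.notMem _
  edge m := by
    have := h.edge (m + k)
    rwa [show m + k + 1 = m + 1 + k by ring] at this

/-- The subgraph of `G` formed by the edges allowed in a bypass. -/
def bypassGraph (G : SimpleGraph V) (c : ℤ → V) : SimpleGraph V where
  Adj x y := G.Adj x y ∧ BypassEdge c x y
  symm := ⟨fun x y h => ⟨h.1.symm, h.2.imp (fun ⟨j, hj⟩ => ⟨j, by tauto⟩) Or.symm⟩⟩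
  loopless := ⟨fun x h => h.1.ne rfl⟩

theorem bypassGraph_le (c : ℤ → V) : bypassGraph G c ≤ G := fun _ _ h => h.1

theorem IsCyc.bypassGraph {l : ℕ} {c : ℤ → V} (h : IsCyc G l c) :
    IsCyc (bypassGraph G c) l c :=
  ⟨h.eq_iff, fun i => ⟨h.adj i, Or.inl ⟨i, Or.inl ⟨rfl, rfl⟩⟩⟩⟩

/-- A path through exactly `c 1, …, c (l - 1)`, and possibly further vertices, closes up to a
bypass. -/
theorem OffCycle.exists_isBypass_of_pathOn {l n : ℕ} {c : ℤ → V} {H : Set V}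
    (K : OffCycle G l c H) {a b : V} {S : Set V} (h : PathOn (bypassGraph G c) a b n S)
    (hba : (bypassGraph G c).Adj b a) (hn : l ≤ n + 1) (hS : ∀ m : ℤ, 1 ≤ m → m < l → c m ∈ S)
    (h0 : c 0 ∉ S) (hSH : ∀ x ∈ S, x ∉ H) : ∃ n d, IsBypass G l c H n d := by
  have := K.three
  obtain ⟨d, hd, hdS⟩ := h.exists_isCyc hba
  have hmem : ∀ m, d m ∈ S := fun m => hdS ▸ ⟨m, rfl⟩
  refine ⟨n, d, hd.mono (bypassGraph_le c), hn, fun j hj => ?_, fun m hm => h0 (hm ▸ hmem m),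
    fun m => hSH _ (hmem m), fun m => (hd.adj m).2⟩
  obtain ⟨m, h1, h2, h3⟩ := K.cyc.exists_mem_window (by omega) 0 j
  have : m ≠ 0 := by
    rintro rfl
    exact hj h3.symm
  rw [hdS, ← h3]
  exact hS m (by omega) (by omega)

variable [Fintype V] [DecidableRel G.Adj]

/-- Every attachment can be bypassed. Otherwise the two cyclic neighbours of `c 0` are not adjacent,
have no common neighbour off the cycle, and no crossing pair of edges; then they form with a vertex
of `H` a triple violating the degree condition at the centre `c 0`. -/
theorem OffCycle.exists_isBypass {l : ℕ} {c : ℤ → V} {H : Set V} (K : OffCycle G l c H)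
    (hT : TripleBound G) (h0 : IsAtt G H (c 0)) : ∃ n d, IsBypass G l c H n d := by
  classical
  by_contra hno
  have h3 := K.three
  have hm1 : c (-1) = c (l - 1) := by
    have := K.cyc.add_period (-1)
    rw [← this, show (-1 + l : ℤ) = l - 1 by ring]
  have hwin : ∀ m m' : ℤ, 0 ≤ m → m < l → 0 ≤ m' → m' < l → c m = c m' → m = m' :=
    fun m m' _ _ _ _ h => K.cyc.eq_of_lt h (by omega) (by omega)
  have h0arc : ∀ i j : ℤ, 1 ≤ i → j < l → c 0 ∉ arc c i j := by
    rintro i j hi hj ⟨m, ⟨hm1, hm2⟩, h⟩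
    have := hwin m 0 (by omega) (by omega) (by omega) (by omega) h
    omega
  have hHarc : ∀ i j : ℤ, ∀ x ∈ arc c i j, x ∉ H := by
    rintro i j _ ⟨m, -, rfl⟩
    exact K.notMem m
  have hp : ¬ IsAtt G H (c 1) := by simpa using K.not_isAtt_succ h0
  have hq : ¬ IsAtt G H (c (-1)) := by simpa using K.not_isAtt_pred h0
  have hB := K.cyc.bypassGraph
  have hedge : ∀ x y, G.Adj x y → (x = c 1 ∨ x = c (-1)) ∨ (y = c 1 ∨ y = c (-1)) →
      (bypassGraph G c).Adj x y := fun x y h h' => ⟨h, Or.inr h'⟩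
  have hA : ¬ G.Adj (c 1) (c (-1)) := by
    intro h
    refine hno (K.exists_isBypass_of_pathOn (hB.pathOn_arc (i := 1) (j := l - 1) (by omega)
      (by omega)) (hedge _ _ (hm1 ▸ h.symm) (Or.inr (Or.inl rfl))) (by omega)
      (fun m h1 h2 => ⟨m, ⟨h1, by omega⟩, rfl⟩) (h0arc _ _ le_rfl (by omega)) (hHarc _ _))
  have hcommon : ∀ o, o ∉ Set.range c → G.Adj (c 1) o → ¬ G.Adj (c (-1)) o := by
    intro o ho h1 h2
    refine hno (K.exists_isBypass_of_pathOn ((hB.pathOn_arc (i := 1) (j := l - 1) (by omega)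
      (by omega)).append (.single o) (hedge _ _ (hm1 ▸ h2) (Or.inl (Or.inr hm1.symm))) ?_)
      (hedge _ _ h1.symm (Or.inr (Or.inl rfl))) (by omega)
      (fun m h1 h2 => Or.inl ⟨m, ⟨h1, by omega⟩, rfl⟩) ?_ ?_)
    · rw [Set.disjoint_singleton_right]
      exact fun h => ho (arc_subset_range _ _ _ h)
    · rintro (h | h)
      · exact h0arc _ _ le_rfl (by omega) h
      · exact ho ⟨0, h⟩
    · rintro x (h | rfl)
      · exact hHarc _ _ _ h
      · exact fun h => hp ⟨x, h, h1⟩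
  have hcross : ∀ m : ℤ, 1 ≤ m → m + 1 < l → G.Adj (c 1) (c (m + 1)) →
      ¬ G.Adj (c (-1)) (c m) := by
    intro m h1 h2 h4 h5
    refine hno (K.exists_isBypass_of_pathOn ((hB.pathOn_arc (i := 1) (j := m) (by omega)
      (by omega)).append (hB.pathOn_arc (i := m + 1) (j := l - 1) (by omega)
      (by omega)).reverse (hedge _ _ (hm1 ▸ h5.symm) (Or.inr (Or.inr hm1.symm))) ?_)
      (hedge _ _ h4.symm (Or.inr (Or.inl rfl))) (by omega) ?_ ?_ ?_)
    · exact K.cyc.disjoint_arc (by omega) (by omega)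
    · intro m' h1' h2'
      rcases le_or_gt m' m with h | h
      · exact Or.inl ⟨m', ⟨h1', h⟩, rfl⟩
      · exact Or.inr ⟨m', ⟨by omega, by omega⟩, rfl⟩
    · rintro (h | h)
      · exact h0arc _ _ le_rfl (by omega) h
      · exact h0arc _ _ (by omega) (by omega) h
    · rintro x (h | h)
      · exact hHarc _ _ _ h
      · exact hHarc _ _ _ h
  obtain ⟨x, hx, h0x⟩ := h0
  have h0 : IsAtt G H (c 0) := ⟨x, hx, h0x⟩
  have hadj1 : G.Adj (c 0) (c 1) := by simpa using K.cyc.adj 0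
  have hadj2 : G.Adj (c 0) (c (-1)) := by simpa using (K.cyc.adj (-1)).symm
  have hx1 : ∀ y, y = x ∨ G.Adj x y → y ≠ c 0 → ¬ G.Adj (c (-1)) y := by
    rintro y (rfl | hy) hy0 h
    · exact hq ⟨y, hx, h⟩
    · have hyH : y ∉ H := fun h' => hq ⟨y, h', h⟩
      obtain ⟨j, rfl⟩ := (K.closed x hx y hy).resolve_left hyH
      have := K.pred_not_adj hT h0 ⟨x, hx, hy.symm⟩ hy0.symm
      exact this (by simpa using h)
  obtain ⟨pr, hpr⟩ := K.cyc.exists_rotate (-1)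
  let f : V → V := fun y => if y ∈ Set.range c ∧ y ≠ c 0 then pr y else y
  have hf : ∀ y, G.Adj (c 1) y →
      (∃ m : ℤ, 1 ≤ m ∧ m + 1 < l ∧ c (m + 1) = y ∧ f y = c m) ∨
      ((y = c 0 ∨ y ∉ Set.range c) ∧ f y = y) := by
    intro y hy
    by_cases hyr : y ∈ Set.range c ∧ y ≠ c 0
    · left
      obtain ⟨⟨j, rfl⟩, hj0⟩ := hyr
      obtain ⟨m, h1, h2, h4⟩ := K.cyc.exists_mem_window (by omega) 0 j
      rw [← h4] at hy hj0 ⊢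
      have e0 : m ≠ 0 := by rintro rfl; exact hj0 rfl
      have e1 : m ≠ 1 := by rintro rfl; exact hy.ne rfl
      refine ⟨m - 1, by omega, by omega, by simp, ?_⟩
      simp only [f, Set.mem_range_self, ne_eq, hj0, not_false_eq_true, and_self, if_true]
      rw [hpr, sub_eq_add_neg]
    · right
      refine ⟨by tauto, by simp only [f, hyr, if_false]⟩
  have hinj : Set.InjOn f (G.neighborFinset (c 1)) := by
    intro y hy y' hy' he
    simp only [Finset.mem_coe, SimpleGraph.mem_neighborFinset] at hy hy'
    rcases hf y hy with ⟨m, h1, h2, h4, h5⟩ | ⟨h4, h5⟩ <;>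
    rcases hf y' hy' with ⟨m', h1', h2', h4', h5'⟩ | ⟨h4', h5'⟩ <;> rw [h5, h5'] at he
    · have := hwin m m' (by omega) (by omega) (by omega) (by omega) he
      subst this
      exact h4.symm.trans h4'
    · rcases h4' with rfl | h4'
      · have := hwin m 0 (by omega) (by omega) (by omega) (by omega) he
        omega
      · exact absurd ⟨_, he⟩ h4'
    · rcases h4 with rfl | h4
      · have := hwin 0 m' (by omega) (by omega) (by omega) (by omega) he
        omega
      · exact absurd ⟨_, he.symm⟩ h4
    · exact he
  have hM : ∀ y, G.Adj (c 1) y → f y ∈ M G 3 (c 0) := by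
    intro y hy
    have hy2 := mem_M_two hadj1 hy
    rcases hf y hy with ⟨m, h1, h2, rfl, h5⟩ | ⟨h4, h5⟩ <;> rw [h5]
    · exact mem_M_succ hy2 (K.cyc.adj m).symm
    · exact M_mono (by omega) hy2
  have hc1 := G.card_neighborFinset_eq_degree (c 1)
  have hc2 := Finset.card_erase_add_one (s := G.neighborFinset (c (-1))) (a := c 0)
    (by simpa using hadj2.symm)
  have hc3 := Finset.card_erase_add_one (s := insert x (G.neighborFinset x)) (a := c 0)
    (by simpa using Or.inr h0x.symm)
  rw [Finset.card_insert_of_notMem (by simp), SimpleGraph.card_neighborFinset_eq_degree] at hc3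
  rw [SimpleGraph.card_neighborFinset_eq_degree] at hc2
  refine hT.false_of_disjoint (v := c 0) (x := c 1) (y := c (-1)) (z := x)
    (M_mono (by omega) (mem_M_one hadj1)) (M_mono (by omega) (mem_M_one hadj2))
    (M_mono (by omega) (mem_M_one h0x)) (fun h => ?_) (fun h => K.notMem _ (h ▸ hx))
    (fun h => K.notMem _ (h ▸ hx)) hA (fun h => hq ⟨x, hx, h⟩) (fun h => hp ⟨x, hx, h⟩)
    (S₁ := (G.neighborFinset (c 1)).image f) (S₂ := (G.neighborFinset (c (-1))).erase (c 0))
    (S₃ := (insert x (G.neighborFinset x)).erase (c 0)) ?_ ?_ ?_ ?_ ?_ ?_ ?_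
  · rw [hm1] at h
    have := hwin 1 (l - 1) (by omega) (by omega) (by omega) (by omega) h
    omega
  · intro u hu
    simp only [Finset.mem_image, SimpleGraph.mem_neighborFinset] at hu
    obtain ⟨y, hy, rfl⟩ := hu
    exact hM y hy
  · intro u hu
    simp only [Finset.mem_erase, SimpleGraph.mem_neighborFinset] at hu
    exact M_mono (by omega) (mem_M_two hadj2 hu.2)
  · intro u hu
    simp only [Finset.mem_erase, Finset.mem_insert, SimpleGraph.mem_neighborFinset] at hu
    rcases hu.2 with rfl | hu
    · exact M_mono (by omega) (mem_M_one h0x)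
    · exact M_mono (by omega) (mem_M_two h0x hu)
  · intro u hu hu'
    simp only [Finset.mem_image, Finset.mem_erase, SimpleGraph.mem_neighborFinset] at hu hu'
    obtain ⟨y, hy, rfl⟩ := hu
    rcases hf y hy with ⟨m, h1, h2, rfl, h5⟩ | ⟨h4, h5⟩ <;> rw [h5] at hu'
    · exact hcross m h1 h2 hy hu'.2
    · exact hcommon y (h4.resolve_left hu'.1) hy hu'.2
  · intro u hu hu'
    simp only [Finset.mem_image, Finset.mem_erase, Finset.mem_insert,
      SimpleGraph.mem_neighborFinset] at hu hu'
    obtain ⟨y, hy, rfl⟩ := hu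
    rcases hf y hy with ⟨m, h1, h2, rfl, h5⟩ | ⟨h4, h5⟩ <;> rw [h5] at hu'
    · rcases hu' with ⟨h6, h7 | h7⟩
      · exact K.notMem _ (h7 ▸ hx)
      · have := K.succ_not_adj_succ (i := m) (j := 0) ⟨x, hx, h7.symm⟩ h0 h6
        exact this (by simpa using hy.symm)
    · have h4 := h4.resolve_left hu'.1
      rcases hu'.2 with rfl | h7
      · exact hp ⟨y, hx, hy⟩
      · exact hp ⟨y, (K.closed x hx y h7).resolve_right h4, hy⟩
  · intro u hu hu'
    simp only [Finset.mem_erase, Finset.mem_insert, SimpleGraph.mem_neighborFinset] at hu hu'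
    exact hx1 u hu'.2 hu.1 hu.2
  · rw [Finset.card_image_of_injOn hinj]
    omega

/-- A cyclic neighbour on a bypass of an attachment is a cyclic neighbour on the original cycle. -/
theorem OffCycle.bypass_neighbor {l n : ℕ} {c d : ℤ → V} {H : Set V} (K : OffCycle G l c H)
    (hT : TripleBound G) (h0 : IsAtt G H (c 0)) (hB : IsBypass G l c H n d) {m : ℤ} {y : V}
    (hm : IsAtt G H (d m)) (hy : y = d (m + 1) ∨ y = d (m - 1)) :
    ∃ j, d m = c j ∧ (y = c (j + 1) ∨ y = c (j - 1)) := by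
  obtain ⟨j, hj⟩ := K.exists_eq_of_isAtt hm (hB.notMem m)
  have hj0 : c 0 ≠ c j := fun h => hB.avoid m (hj.symm.trans h.symm)
  refine ⟨j, hj.symm, ?_⟩
  have hadj : G.Adj (c j) y := by
    rw [hj]
    rcases hy with rfl | rfl
    · exact hB.cyc.adj m
    · simpa using (hB.cyc.adj (m - 1)).symm
  have he : BypassEdge c (c j) y := by
    rw [hj]
    rcases hy with rfl | rfl
    · exact hB.edge m
    · have := hB.edge (m - 1)
      rw [sub_add_cancel] at this
      rcases this with ⟨i, hi⟩ | h
      · exact Or.inl ⟨i, by tauto⟩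
      · exact Or.inr (by tauto)
  have hja : IsAtt G H (c j) := hj ▸ hm
  have hp : ¬ IsAtt G H (c 1) := by simpa using K.not_isAtt_succ h0
  have hq : ¬ IsAtt G H (c (-1)) := by simpa using K.not_isAtt_pred h0
  have hp' : ¬ G.Adj (c j) (c 1) := fun h => K.succ_not_adj hT h0 hja hj0 (by simpa using h.symm)
  have hq' : ¬ G.Adj (c j) (c (-1)) := fun h =>
    K.pred_not_adj hT h0 hja hj0 (by simpa using h.symm)
  rcases he with ⟨i, ⟨h1, h2⟩ | ⟨h1, h2⟩⟩ | (h | h) | (h | h)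
  · left
    rw [h2, K.cyc.eq_add h1]
  · right
    rw [h2, sub_eq_add_neg, K.cyc.eq_add h1]
    congr 1; ring
  · exact absurd (h ▸ hja) hp
  · exact absurd (h ▸ hja) hq
  · exact absurd (h ▸ hadj) hp'
  · exact absurd (h ▸ hadj) hq'

end Bypass

section Far

variable {V : Type*} [Fintype V] {G : SimpleGraph V} [DecidableRel G.Adj]

/-! ### Vertices far apart along a bypass -/

/-- The successor of an attachment on a bypass is not adjacent to `H`, nor to another
attachment. -/
theorem OffCycle.bypass_succ {l n : ℕ} {c d : ℤ → V} {H : Set V} (K : OffCycle G l c H)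
    (hT : TripleBound G) (h0 : IsAtt G H (c 0)) (hB : IsBypass G l c H n d) {k : ℤ}
    (hk : IsAtt G H (d k)) : ¬ IsAtt G H (d (k + 1)) ∧
      ∀ i, IsAtt G H (c i) → c i ≠ d k → ¬ G.Adj (d (k + 1)) (c i) := by
  obtain ⟨j, hj, hpj⟩ := K.bypass_neighbor hT h0 hB hk (Or.inl rfl)
  have hja : IsAtt G H (c j) := hj ▸ hk
  constructor
  · rcases hpj with h | h <;> rw [h]
    · exact K.not_isAtt_succ hja
    · exact K.not_isAtt_pred hja
  · intro i hi hne
    have hne' : c j ≠ c i := fun h => hne (by rw [hj, h])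
    rcases hpj with h | h <;> rw [h]
    · exact K.succ_not_adj hT hja hi hne'
    · exact K.pred_not_adj hT hja hi hne'

/-- Let `d` bypass the attachment `c 0`, let `d 0` be a neighbour of `c 0`, and let `d k` be an
attachment. The path that runs from `d 1` along the bypass to `d k`, through `H` to `c 0`, on to
`d 0 = d n` and back along the bypass to `d (k + 1)` has more vertices than a longest cycle. So
the neighbours of `d (k + 1)`, those of `d 1` moved one step along this path towards `d 1`, and
those of `z` hardly collide, and the degree condition at the centre `d 0` is violated unless
`d (k + 1)` is far from `d 0`. -/
theorem OffCycle.notMem_M_two {l n : ℕ} {c d : ℤ → V} {H : Set V} (K : OffCycle G l c H)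
    (hT : TripleBound G) (hB : IsBypass G l c H n d) {k : ℤ} {z : V} (hz : z ∈ H)
    (h0z : G.Adj (c 0) z) (hs : G.Adj (d 0) (c 0)) (hs' : ¬ IsAtt G H (d 0)) (hk : 0 < k)
    (hkn : k < n) (hka : IsAtt G H (d k)) (hzk : ∀ m, k < m → m < n → ¬ G.Adj z (d m)) :
    d (k + 1) ∉ M G 2 (d 0) := by
  classical
  intro hpM
  have h0 : IsAtt G H (c 0) := ⟨z, hz, h0z⟩
  have hav := hB.avoid
  have hzs : z ∈ M G 2 (d 0) := mem_M_two hs h0z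
  obtain ⟨hp, hpatt⟩ := K.bypass_succ hT h0 hB hka
  have hp0 : ¬ G.Adj (d (k + 1)) (c 0) := hpatt 0 h0 (hav k).symm
  have hkn' : k + 1 < n := by
    have : k + 1 ≠ n := by
      intro h
      rw [h, hB.cyc.period] at hp0
      exact hp0 hs
    omega
  have hq : ¬ IsAtt G H (d 1) := by
    intro h
    obtain ⟨i, hi, hsi⟩ := K.bypass_neighbor hT h0 hB (m := 1) h (Or.inr rfl)
    have hia : IsAtt G H (c i) := hi ▸ h
    have hne : c i ≠ c 0 := fun h => hav 1 (hi.trans h)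
    rw [sub_self] at hsi
    rcases hsi with h | h <;> rw [h] at hs
    · exact K.succ_not_adj hT hia h0 hne hs
    · exact K.pred_not_adj hT hia h0 hne hs
  obtain ⟨x, hx, hkx⟩ := hka
  have hka : IsAtt G H (d k) := ⟨x, hx, hkx⟩
  obtain ⟨r, S, hS, hSH⟩ := K.conn z hz x hx
  -- At least two vertices of the ear outweigh the vertex that the bypass may have lost.
  have hE : IsEar G n d k (1 + r) (c 0) x ({c 0} ∪ S) :=
    { cyc := hB.cyc
      pos := hk
      lt := hkn
      path := (PathOn.single (c 0)).append hS h0z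
        (Set.disjoint_singleton_left.2 fun h => K.notMem 0 (hSH h))
      left := hs
      right := hkx.symm
      notMem := fun i h => h.elim (fun h => hav i h) fun h => hB.notMem i (hSH h) }
  have hr := hS.one_le
  have hlen := hB.len
  have hr' : l < n + (1 + r) := by omega
  -- Inserting `z` and `c 0` between `d 0` and a neighbour of `z` on the bypass.
  have hins : ∀ m : ℤ, 0 < m → m < n → G.Adj z (d m) → ¬ G.Adj (d 1) (d (m + 1)) := by
    intro m h1 h2 h3
    have hE' : IsEar G n d m (1 + 1) (c 0) z ({c 0} ∪ {z}) :=
      { cyc := hB.cyc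
        pos := h1
        lt := h2
        path := (PathOn.single (c 0)).append (PathOn.single z) h0z
          (Set.disjoint_singleton_left.2 fun h => h0z.ne h)
        left := hs
        right := h3
        notMem := fun i h => h.elim (fun h => hav i h) fun h => hB.notMem i (h ▸ hz) }
    exact hE'.not_adj K.bound (by omega)
  have hwin : ∀ m m' : ℤ, 1 ≤ m → m ≤ n → 1 ≤ m' → m' ≤ n → d m = d m' → m = m' :=
    fun m m' _ _ _ _ h => hB.cyc.eq_of_lt h (by omega) (by omega)
  have hI : ∀ m : ℤ, 1 ≤ m → m ≤ n → (d m ∈ arc d 1 k ↔ m ≤ k) := by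
    intro m hm hml
    refine ⟨?_, fun h => ⟨m, ⟨hm, h⟩, rfl⟩⟩
    rintro ⟨m', ⟨hm1, hm2⟩, h⟩
    have := hwin m' m (by omega) (by omega) hm hml h
    omega
  obtain ⟨pr, hpr⟩ := hB.cyc.exists_rotate (-1)
  obtain ⟨su, hsu⟩ := hB.cyc.exists_rotate 1
  let g : V → V := fun y => if y = d 0 then c 0 else if y ∈ arc d 1 k then pr y else
    if y ∈ Set.range d then su y else y
  have hg : ∀ y, G.Adj (d 1) y →
      (∃ m : ℤ, 1 ≤ m ∧ m + 1 ≤ k ∧ d (m + 1) = y ∧ g y = d m) ∨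
      (∃ m : ℤ, k < m ∧ m + 1 ≤ n ∧ d m = y ∧ g y = d (m + 1)) ∨
      (y = d 0 ∧ g y = c 0) ∨ (y ∉ Set.range d ∧ g y = y) := by
    intro y hy
    by_cases hyr : y ∈ Set.range d
    · obtain ⟨i, rfl⟩ := hyr
      obtain ⟨m, h1, h2, h3⟩ := hB.cyc.exists_mem_window (by omega) 0 i
      rw [← h3] at hy ⊢
      by_cases hm0 : m = 0
      · subst hm0
        exact Or.inr (Or.inr (Or.inl ⟨rfl, by simp [g]⟩))
      have hne : d m ≠ d 0 := fun h => hm0 (hB.cyc.eq_of_lt h (by omega) (by omega))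
      rcases le_or_gt m k with h4 | h4
      · have hm1 : m ≠ 1 := by rintro rfl; exact hy.ne rfl
        refine Or.inl ⟨m - 1, by omega, by omega, by simp, ?_⟩
        simp [g, hne, hI m (by omega) (by omega), h4, hpr, sub_eq_add_neg]
      · refine Or.inr (Or.inl ⟨m, h4, by omega, rfl, ?_⟩)
        simp [g, hne, hI m (by omega) (by omega), not_le.2 h4, hsu]
    · refine Or.inr (Or.inr (Or.inr ⟨hyr, ?_⟩))
      have h1 : y ≠ d 0 := fun h => hyr ⟨0, h.symm⟩
      have h2 : y ∉ arc d 1 k := fun h => hyr (arc_subset_range _ _ _ h)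
      simp only [g, h1, h2, hyr, if_false]
  have hinj : Set.InjOn g ((G.neighborFinset (d 1)).erase (c 0)) := by
    intro y hy y' hy' he
    simp only [Finset.coe_erase, Set.mem_sdiff, Finset.mem_coe, SimpleGraph.mem_neighborFinset,
      Set.mem_singleton_iff] at hy hy'
    obtain ⟨hy, hy0⟩ := hy
    obtain ⟨hy', hy0'⟩ := hy'
    rcases hg y hy with ⟨m, h1, h2, h4, h5⟩ | ⟨m, h1, h2, h4, h5⟩ | ⟨h4, h5⟩ | ⟨h4, h5⟩ <;>
    rcases hg y' hy' with ⟨m', h1', h2', h4', h5'⟩ | ⟨m', h1', h2', h4', h5'⟩ | ⟨h4', h5'⟩ |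
      ⟨h4', h5'⟩ <;> rw [h5, h5'] at he <;>
    first
      | exact he
      | exact h4.trans h4'.symm
      | exact absurd he (hav _)
      | exact absurd he.symm (hav _)
      | exact absurd he hy0
      | exact absurd he.symm hy0'
      | exact absurd ⟨_, he⟩ h4'
      | exact absurd ⟨_, he.symm⟩ h4
      | (have := hwin _ _ (by omega) (by omega) (by omega) (by omega) he
         first
           | omega
           | (obtain rfl : m = m' := by omega
              exact h4.symm.trans h4'))
  have hc2 : G.degree (d 1) ≤ ((G.neighborFinset (d 1)).erase (c 0)).card + 1 := by
    have := Finset.pred_card_le_card_erase (s := G.neighborFinset (d 1)) (a := c 0)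
    rw [SimpleGraph.card_neighborFinset_eq_degree] at this
    omega
  have hpH : ∀ y, G.Adj (d (k + 1)) y → y ∉ H := fun y h h' => hp ⟨y, h', h⟩
  have hqH : ∀ y, G.Adj (d 1) y → y ∉ H := fun y h h' => hq ⟨y, h', h⟩
  -- Adding `d (k + 1)` and `z` makes up for the removal of `c 0` and `d k`.
  set Z : Finset V := insert (d (k + 1)) (insert z (G.neighborFinset z)) \ {c 0, d k} with hZdef
  have hmemZ : ∀ y, y ∈ Z → (y = d (k + 1) ∨ y = z ∨ G.Adj z y) ∧ y ≠ c 0 ∧ y ≠ d k := by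
    intro y hy
    simpa [hZdef, not_or] using hy
  have hpz : d (k + 1) ≠ z := fun h => hB.notMem _ (h ▸ hz)
  have hcardZ : G.degree z ≤ Z.card := by
    have h3 : _ ≤ Z.card :=
      Finset.le_card_sdiff {c 0, d k} (insert (d (k + 1)) (insert z (G.neighborFinset z)))
    rw [Finset.card_insert_of_notMem (by
        simp only [Finset.mem_insert, SimpleGraph.mem_neighborFinset, not_or]
        exact ⟨hpz, fun h => hpH z h.symm hz⟩),
      Finset.card_insert_of_notMem (by simp), SimpleGraph.card_neighborFinset_eq_degree] at h3
    have h4 : ({c 0, d k} : Finset V).card ≤ 2 := Finset.card_le_two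
    omega
  have hsq : G.Adj (d 0) (d 1) := by simpa using hB.cyc.adj 0
  have hpq : ¬ G.Adj (d 1) (d (k + 1)) := hE.not_adj K.bound hr'
  refine hT.false_of_disjoint (v := d 0) (x := d (k + 1)) (y := d 1) (z := z) hpM
    (M_mono (by omega) (mem_M_one hsq)) hzs (fun h => ?_) (fun h => hB.notMem _ (h ▸ hz)) hpz
    (fun h => hpq h.symm) (fun h => hqH z h hz) (fun h => hpH z h hz)
    (S₁ := G.neighborFinset (d (k + 1))) (S₂ := ((G.neighborFinset (d 1)).erase (c 0)).image g)
    (S₃ := Z) ?_ ?_ ?_ ?_ ?_ ?_ ?_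
  · have := hwin _ _ (by omega) (by omega) (by omega) (by omega) h
    omega
  · intro u hu
    rw [SimpleGraph.mem_neighborFinset] at hu
    exact mem_M_succ hpM hu
  · intro u hu
    simp only [Finset.mem_image, Finset.mem_erase, SimpleGraph.mem_neighborFinset] at hu
    obtain ⟨y, ⟨hy0, hy⟩, rfl⟩ := hu
    have hy2 := mem_M_two hsq hy
    rcases hg y hy with ⟨m, h1, h2, rfl, h5⟩ | ⟨m, h1, h2, rfl, h5⟩ | ⟨h4, h5⟩ | ⟨h4, h5⟩ <;>
      rw [h5]
    · exact mem_M_succ hy2 (hB.cyc.adj m).symm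
    · exact mem_M_succ hy2 (hB.cyc.adj m)
    · exact M_mono (by omega) (mem_M_one hs)
    · exact M_mono (by omega) hy2
  · intro u hu
    rcases (hmemZ u hu).1 with rfl | rfl | h
    · exact M_mono (by omega) hpM
    · exact M_mono (by omega) hzs
    · exact mem_M_succ hzs h
  · intro u hu hu'
    simp only [Finset.mem_image, Finset.mem_erase, SimpleGraph.mem_neighborFinset] at hu hu'
    obtain ⟨y, ⟨hy0, hy⟩, rfl⟩ := hu'
    rcases hg y hy with ⟨m, h1, h2, rfl, h5⟩ | ⟨m, h1, h2, rfl, h5⟩ | ⟨h4, h5⟩ | ⟨h4, h5⟩ <;>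
      rw [h5] at hu
    · exact hE.not_cross K.bound hr' h1 h2 hy.symm hu.symm
    · exact hE.not_cross' K.bound hr' h1 h2 hy.symm hu.symm
    · exact hp0 hu
    · refine hE.not_common_neighbor K.bound hr' h4 ?_ hy hu
      rintro (h | h)
      · exact hy0 h
      · exact hqH _ hy (hSH h)
  · intro u hu hu'
    rw [SimpleGraph.mem_neighborFinset] at hu
    obtain ⟨h1, h2, h3⟩ := hmemZ u hu'
    rcases h1 with rfl | rfl | h1
    · exact hu.ne rfl
    · exact hpH _ hu hz
    · obtain ⟨i, rfl⟩ := (K.closed z hz u h1).resolve_left (hpH _ hu)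
      exact hpatt i ⟨z, hz, h1.symm⟩ h3 hu
  · intro u hu hu'
    obtain ⟨h1, h2, h3⟩ := hmemZ u hu'
    simp only [Finset.mem_image, Finset.mem_erase, SimpleGraph.mem_neighborFinset] at hu
    obtain ⟨y, ⟨hy0, hy⟩, rfl⟩ := hu
    rcases hg y hy with ⟨m, h4, h5, rfl, h6⟩ | ⟨m, h4, h5, rfl, h6⟩ | ⟨h4, h6⟩ | ⟨h4, h6⟩ <;>
      rw [h6] at h1 h2
    · rcases h1 with h1 | h1 | h1
      · have := hwin _ _ (by omega) (by omega) (by omega) (by omega) h1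
        omega
      · exact hB.notMem _ (h1 ▸ hz)
      · exact hins m (by omega) (by omega) h1 hy
    · rcases h1 with h1 | h1 | h1
      · have := hwin _ _ (by omega) (by omega) (by omega) (by omega) h1
        omega
      · exact hB.notMem _ (h1 ▸ hz)
      · rcases (by omega : m + 1 < n ∨ m + 1 = n) with h7 | h7
        · exact hzk _ (by omega) h7 h1
        · rw [h7, hB.cyc.period] at h1
          exact hs' ⟨z, hz, h1.symm⟩
    · exact h2 rfl
    · rcases h1 with rfl | rfl | h1
      · exact h4 ⟨_, rfl⟩
      · exact hqH _ hy hz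
      · obtain ⟨i, rfl⟩ := (K.closed z hz y h1).resolve_left (hqH _ hy)
        exact h4 (hB.cover i h2)
  · rw [Finset.card_image_of_injOn hinj, SimpleGraph.card_neighborFinset_eq_degree]
    omega

/-- Two vertices `p`, `s` that are not adjacent to `H`, and whose neighbourhoods meet that of
`z ∈ H` in at most two vertices, have distance at most `2` if all three are near some `w`. -/
theorem OffCycle.mem_M_two_of_center {l : ℕ} {c : ℤ → V} {H : Set V} (K : OffCycle G l c H)
    (hT : TripleBound G) {p s z w a b : V} (hz : z ∈ H) (hpH : p ∉ H) (hsH : s ∉ H)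
    (hp : ¬ IsAtt G H p) (hs : ¬ IsAtt G H s) (hpw : p ∈ M G 2 w) (hsw : s ∈ M G 2 w)
    (hzw : z ∈ M G 2 w)
    (hzp : ∀ i, G.Adj z (c i) → c i ≠ a → c i ≠ b → ¬ G.Adj p (c i))
    (hzs : ∀ i, G.Adj z (c i) → c i ≠ a → c i ≠ b → ¬ G.Adj s (c i)) : p ∈ M G 2 s := by
  classical
  by_contra hps
  have hcommon : ∀ o, G.Adj p o → ¬ G.Adj s o := fun o h h' => hps (mem_M_two h' h.symm)
  set Z : Finset V := insert z (G.neighborFinset z) \ {a, b} with hZdef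
  have hmemZ : ∀ y, y ∈ Z → (y = z ∨ G.Adj z y) ∧ y ≠ a ∧ y ≠ b := by
    intro y hy
    simpa [hZdef, not_or] using hy
  have hcardZ : G.degree z ≤ Z.card + 1 := by
    have h3 : _ ≤ Z.card := Finset.le_card_sdiff {a, b} (insert z (G.neighborFinset z))
    rw [Finset.card_insert_of_notMem (by simp), SimpleGraph.card_neighborFinset_eq_degree] at h3
    have h4 : ({a, b} : Finset V).card ≤ 2 := Finset.card_le_two
    omega
  have hdis : ∀ v, ¬ IsAtt G H v →
      (∀ i, G.Adj z (c i) → c i ≠ a → c i ≠ b → ¬ G.Adj v (c i)) →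
      ∀ u ∈ G.neighborFinset v, u ∉ Z := by
    intro v hv hzv u hu hu'
    rw [SimpleGraph.mem_neighborFinset] at hu
    obtain ⟨h1, h2, h3⟩ := hmemZ u hu'
    rcases h1 with rfl | h1
    · exact hv ⟨u, hz, hu⟩
    · obtain ⟨i, rfl⟩ := (K.closed z hz u h1).resolve_left fun h => hv ⟨u, h, hu⟩
      exact hzv i h1 h2 h3 hu
  refine hT.false_of_disjoint (x := p) (y := s) (z := z) hpw hsw hzw
    (fun h => hps (h ▸ mem_M_self _ _)) (fun h => hsH (h ▸ hz)) (fun h => hpH (h ▸ hz))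
    (fun h => hps (M_mono (by omega) (mem_M_one h.symm))) (fun h => hs ⟨z, hz, h⟩)
    (fun h => hp ⟨z, hz, h⟩) (S₁ := G.neighborFinset p) (S₂ := G.neighborFinset s) (S₃ := Z)
    ?_ ?_ ?_ ?_ (hdis p hp hzp) (hdis s hs hzs) ?_
  · intro u hu
    rw [SimpleGraph.mem_neighborFinset] at hu
    exact mem_M_succ hpw hu
  · intro u hu
    rw [SimpleGraph.mem_neighborFinset] at hu
    exact mem_M_succ hsw hu
  · intro u hu
    rcases (hmemZ u hu).1 with rfl | h
    · exact M_mono (by omega) hzw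
    · exact mem_M_succ hzw h
  · intro u hu hu'
    rw [SimpleGraph.mem_neighborFinset] at hu hu'
    exact hcommon u hu hu'
  · simp only [SimpleGraph.card_neighborFinset_eq_degree]
    omega

end Far

section Cases

variable {V : Type*} [Fintype V] {G : SimpleGraph V} [DecidableRel G.Adj]

/-! ### Attachments of single vertices of the component -/

/-- A vertex of `H` has at most one neighbour on the cycle. For neighbours `c 0` and `c j` of `z`,
take the successor on a bypass of `c 0` of the last neighbour of `z`, counted from `c 1`. Counting
at the centre `z` shows that it is at distance at most `2` from `c 1`, against `notMem_M_two`. -/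
theorem OffCycle.not_adj_of_adj_zero {l : ℕ} {c : ℤ → V} {H : Set V} (K : OffCycle G l c H)
    (hT : TripleBound G) {z : V} (hz : z ∈ H) (h0 : G.Adj z (c 0)) {j : ℤ} (hj : c j ≠ c 0) :
    ¬ G.Adj z (c j) := by
  intro hzj
  have h3 := K.three
  have h0a : IsAtt G H (c 0) := ⟨z, hz, h0.symm⟩
  have h1a : ¬ IsAtt G H (c 1) := by simpa using K.not_isAtt_succ h0a
  have h01 : G.Adj (c 0) (c 1) := by simpa using K.cyc.adj 0
  obtain ⟨n, d', hB'⟩ := K.exists_isBypass hT h0a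
  obtain ⟨e, he⟩ := hB'.cover 1 h01.ne'
  obtain ⟨d, hB, hd0⟩ : ∃ d, IsBypass G l c H n d ∧ d 0 = c 1 := ⟨_, hB'.shift e, by simpa using he⟩
  have hlen := hB.len
  obtain ⟨i, hi⟩ := hB.cover j hj
  obtain ⟨m, hm1, hm2, hm3⟩ := hB.cyc.exists_mem_window (by omega) 0 i
  rw [← hi, ← hm3] at hzj
  have hm0 : m ≠ 0 := by
    rintro rfl
    rw [hd0] at hzj
    exact h1a ⟨z, hz, hzj.symm⟩
  obtain ⟨k, ⟨hk, hkn, hzk⟩, hmax⟩ := Int.exists_greatest_of_bdd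
    (P := fun k => 0 < k ∧ k < n ∧ G.Adj z (d k)) ⟨n, fun k h => h.2.1.le⟩
    ⟨m, by omega, by omega, hzj⟩
  have hka : IsAtt G H (d k) := ⟨z, hz, hzk.symm⟩
  obtain ⟨hp, hpatt⟩ := K.bypass_succ hT h0a hB hka
  refine K.notMem_M_two hT hB hz h0.symm (hd0 ▸ h01.symm) (hd0 ▸ h1a) hk hkn hka
    (fun m h1 h2 h3 => not_lt.2 (hmax m ⟨by omega, h2, h3⟩) h1) ?_
  refine K.mem_M_two_of_center hT (z := z) (w := z) (a := c 0) (b := d k) hz (hB.notMem _)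
    (hB.notMem _) hp (hd0 ▸ h1a) (mem_M_two hzk (hB.cyc.adj k)) (hd0 ▸ mem_M_two h0 h01)
    (mem_M_self _ _) (fun i hi _ h => hpatt i ⟨z, hz, hi.symm⟩ h) (fun i hi h _ => ?_)
  rw [hd0]
  simpa using K.succ_not_adj hT h0a ⟨z, hz, hi.symm⟩ h.symm

theorem OffCycle.eq_of_adj {l : ℕ} {c : ℤ → V} {H : Set V} (K : OffCycle G l c H)
    (hT : TripleBound G) {z : V} (hz : z ∈ H) {i j : ℤ} (hi : G.Adj z (c i)) (hj : G.Adj z (c j)) :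
    c i = c j := by
  by_contra h
  refine (K.shift i).not_adj_of_adj_zero hT hz (j := j - i) ?_ ?_ ?_
  · simpa using hi
  · simpa using fun h' => h h'.symm
  · simpa using hj

/-! ### Leaving the component through a second attachment -/

/-- A neighbour `s` of the attachment `c 0` that lies off the bypass extends the path through `H`
between the attachments `d 0` and `c 0`. Hence the neighbours of `s`, moved one step along the
bypass where they are adjacent to `d 1`, avoid those of `d 1`, and the degree condition fails at
the centre `d 1`. -/
theorem OffCycle.notMem_M_two_of_notMem_range {l n : ℕ} {c d : ℤ → V} {H : Set V}
    (K : OffCycle G l c H) (hT : TripleBound G) (hB : IsBypass G l c H n d) {x s : V} (hx : x ∈ H)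
    (hxd : G.Adj x (d 0)) (h0 : IsAtt G H (c 0)) (hs0 : G.Adj s (c 0)) (hsH : s ∉ H)
    (hs : ¬ IsAtt G H s) (hsd : s ∉ Set.range d) : s ∉ M G 2 (d 1) := by
  classical
  intro hsM
  have h3 := K.three
  have hlen := hB.len
  have hsc : s ∉ Set.range c := by
    rintro ⟨j, rfl⟩
    exact hsd (hB.cover j hs0.ne)
  have hda : IsAtt G H (d 0) := ⟨x, hx, hxd.symm⟩
  obtain ⟨hp, hpatt⟩ := K.bypass_succ hT h0 hB hda
  rw [zero_add] at hp hpatt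
  have hp0 : ¬ G.Adj (d 1) (c 0) := hpatt 0 h0 (hB.avoid 0).symm
  have hd01 : G.Adj (d 0) (d 1) := by simpa using hB.cyc.adj 0
  obtain ⟨y, hy, h0y⟩ := h0
  obtain ⟨r, S, hS, hSH⟩ := K.conn x hx y hy
  have hr := hS.one_le
  -- With at least three vertices, the path from `x` through `H` and `c 0` to `s` outweighs the
  -- vertex that the bypass may have lost.
  have hQ : PathOn G x s (r + 1 + 1) (S ∪ {c 0} ∪ {s}) := by
    refine (hS.append (.single _) h0y.symm ?_).append (.single s) hs0.symm ?_
    · rw [Set.disjoint_singleton_right]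
      exact fun h => K.notMem 0 (hSH h)
    · rw [Set.disjoint_singleton_right]
      rintro (h | h)
      · exact hsH (hSH h)
      · exact hs0.ne h
  have hdQ : ∀ i, d i ∉ S ∪ {c 0} ∪ {s} := by
    rintro i ((h | h) | h)
    · exact hB.notMem i (hSH h)
    · exact hB.avoid i h
    · exact hsd ⟨i, h⟩
  have hps : ¬ G.Adj (d 1) s := by
    intro h
    have := hB.cyc.length_le_of_insert K.bound hQ hdQ (i := 0) hxd.symm (by simpa using h.symm)
      (by omega)
    omega
  have hcommon : ∀ f, G.Adj s f → G.Adj (d 1) f → f ∈ Set.range d := by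
    intro f hf hpf
    by_contra hfd
    have := hB.cyc.length_le_of_insert K.bound (hQ.append (.single f) hf (by
      rw [Set.disjoint_singleton_right]
      rintro ((h | h) | h)
      · exact hp ⟨f, hSH h, hpf⟩
      · exact hp0 (h ▸ hpf)
      · exact hf.ne' h)) (i := 0) (by
        rintro i (h | h)
        · exact hdQ i h
        · exact hfd ⟨i, h⟩) hxd.symm (by simpa using hpf.symm) (by omega)
    omega
  have hstep : ∀ m : ℤ, 0 < m → m < n → G.Adj s (d m) → ¬ G.Adj (d 1) (d (m + 1)) := by
    intro m h1 h2 h4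
    have hE : IsEar G n d m (r + 1 + 1) x s (S ∪ {c 0} ∪ {s}) :=
      ⟨hB.cyc, h1, h2, hQ, hxd.symm, h4, hdQ⟩
    exact hE.not_adj K.bound (by omega)
  have hsucc : ∀ i, G.Adj s (c i) → ¬ G.Adj s (c (i + 1)) := by
    intro i h1 h2
    have := K.cyc.length_le_of_insert K.bound (.single s) (fun j h => hsc ⟨j, h⟩) (i := i) h1.symm
      h2 (by omega)
    omega
  have hs1 : ¬ G.Adj s (c 1) := by simpa using hsucc 0 hs0
  have hs1' : ¬ G.Adj s (c (-1)) := fun h => hsucc (-1) h (by simpa using hs0)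
  have hedge : ∀ m, G.Adj s (d m) → ¬ G.Adj s (d (m + 1)) := by
    intro m h1 h2
    rcases hB.edge m with ⟨i, ⟨h4, h5⟩ | ⟨h4, h5⟩⟩ | (h | h) | (h | h)
    · exact hsucc i (h4 ▸ h1) (h5 ▸ h2)
    · exact hsucc i (h5 ▸ h2) (h4 ▸ h1)
    · exact hs1 (h ▸ h1)
    · exact hs1' (h ▸ h1)
    · exact hs1 (h ▸ h2)
    · exact hs1' (h ▸ h2)
  have hxN : ∀ u, G.Adj x u → u ∉ H → u = d 0 := by
    intro u hu huH
    obtain ⟨j, hj⟩ := K.exists_eq_of_isAtt hda (hB.notMem 0)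
    obtain ⟨i, rfl⟩ := (K.closed x hx u hu).resolve_left huH
    rw [← hj]
    exact K.eq_of_adj hT hx hu (hj ▸ hxd)
  obtain ⟨su, hsu⟩ := hB.cyc.exists_rotate 1
  let g : V → V := fun y => if G.Adj (d 1) y then su y else y
  have hg : ∀ y, G.Adj s y → y ≠ d 0 →
      (∃ m : ℤ, 0 < m ∧ m < n ∧ d m = y ∧ G.Adj (d 1) (d m) ∧ g y = d (m + 1)) ∨
      (¬ G.Adj (d 1) y ∧ g y = y) := by
    intro y hy hy0
    by_cases hpy : G.Adj (d 1) y
    · left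
      obtain ⟨i, hi⟩ := hcommon y hy hpy
      obtain ⟨m, h1, h2, h4⟩ := hB.cyc.exists_mem_window (by omega) 0 i
      rw [hi] at h4
      subst h4
      have hm0 : m ≠ 0 := by
        rintro rfl
        exact hy0 rfl
      exact ⟨m, by omega, by omega, rfl, hpy, by simp only [g, hpy, if_true, hsu]⟩
    · exact Or.inr ⟨hpy, by simp only [g, hpy, if_false]⟩
  have hinj : Set.InjOn g ((G.neighborFinset s).erase (d 0)) := by
    intro y hy y' hy' he
    simp only [Finset.coe_erase, Set.mem_sdiff, Finset.mem_coe, SimpleGraph.mem_neighborFinset,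
      Set.mem_singleton_iff] at hy hy'
    rcases hg y hy.1 hy.2 with ⟨m, h1, h2, rfl, h4, h5⟩ | ⟨h4, h5⟩ <;>
    rcases hg y' hy'.1 hy'.2 with ⟨m', h1', h2', rfl, h4', h5'⟩ | ⟨h4', h5'⟩ <;>
    rw [h5, h5'] at he
    · have := hB.cyc.eq_add he (-1)
      simpa using this
    · exact absurd (he ▸ hy'.1) (hedge m hy.1)
    · exact absurd (he ▸ hy.1) (hedge m' hy'.1)
    · exact he
  have hc2 := Finset.pred_card_le_card_erase (s := G.neighborFinset s) (a := d 0)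
  have hc3 := Finset.card_erase_add_one (s := insert x (G.neighborFinset x)) (a := d 0)
    (by simpa using Or.inr hxd)
  rw [Finset.card_insert_of_notMem (by simp), SimpleGraph.card_neighborFinset_eq_degree] at hc3
  rw [SimpleGraph.card_neighborFinset_eq_degree] at hc2
  have hxM : x ∈ M G 2 (d 1) := mem_M_two hd01.symm hxd.symm
  refine hT.false_of_disjoint (v := d 1) (x := d 1) (y := s) (z := x) (mem_M_self _ _) hsM hxM
    (fun h => hsd ⟨1, h⟩) (fun h => hsH (h ▸ hx)) (fun h => hB.notMem 1 (h ▸ hx)) hps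
    (fun h => hs ⟨x, hx, h⟩) (fun h => hp ⟨x, hx, h⟩) (S₁ := G.neighborFinset (d 1))
    (S₂ := ((G.neighborFinset s).erase (d 0)).image g)
    (S₃ := (insert x (G.neighborFinset x)).erase (d 0)) ?_ ?_ ?_ ?_ ?_ ?_ ?_
  · intro u hu
    rw [SimpleGraph.mem_neighborFinset] at hu
    exact M_mono (by omega) (mem_M_one hu)
  · intro u hu
    simp only [Finset.mem_image, Finset.mem_erase, SimpleGraph.mem_neighborFinset] at hu
    obtain ⟨y, ⟨hy0, hy⟩, rfl⟩ := hu
    rcases hg y hy hy0 with ⟨m, h1, h2, rfl, h4, h5⟩ | ⟨h4, h5⟩ <;> rw [h5]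
    · exact M_mono (by omega) (mem_M_two h4 (hB.cyc.adj m))
    · exact mem_M_succ hsM hy
  · intro u hu
    simp only [Finset.mem_erase, Finset.mem_insert, SimpleGraph.mem_neighborFinset] at hu
    rcases hu.2 with rfl | h
    · exact M_mono (by omega) hxM
    · exact mem_M_succ hxM h
  · intro u hu hu'
    simp only [Finset.mem_image, Finset.mem_erase, SimpleGraph.mem_neighborFinset] at hu hu'
    obtain ⟨y, ⟨hy0, hy⟩, rfl⟩ := hu'
    rcases hg y hy hy0 with ⟨m, h1, h2, rfl, h4, h5⟩ | ⟨h4, h5⟩ <;> rw [h5] at hu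
    · exact hstep m h1 h2 hy hu
    · exact h4 hu
  · intro u hu hu'
    simp only [Finset.mem_erase, Finset.mem_insert, SimpleGraph.mem_neighborFinset] at hu hu'
    obtain ⟨h1, rfl | h2⟩ := hu'
    · exact hp ⟨_, hx, hu⟩
    · exact h1 (hxN u h2 fun h => hp ⟨u, h, hu⟩)
  · intro u hu hu'
    simp only [Finset.mem_image, Finset.mem_erase, Finset.mem_insert,
      SimpleGraph.mem_neighborFinset] at hu hu'
    obtain ⟨y, ⟨hy0, hy⟩, rfl⟩ := hu
    obtain ⟨h1, h2⟩ := hu'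
    rcases hg y hy hy0 with ⟨m, -, -, rfl, h4, h5⟩ | ⟨h4, h5⟩ <;> rw [h5] at h1 h2
    · rcases h2 with h2 | h2
      · exact hB.notMem _ (h2 ▸ hx)
      · exact h1 (hxN _ h2 (hB.notMem _))
    · rcases h2 with rfl | h2
      · exact hs ⟨_, hx, hy⟩
      · exact h1 (hxN _ h2 fun h => hs ⟨y, h, hy⟩)
  · rw [Finset.card_image_of_injOn hinj, SimpleGraph.card_neighborFinset_eq_degree]
    omega

/-- Let `v` and `c 0` be distinct attachments. Then the neighbours of `c 0` within distance `3` of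
`v` are attachments or vertices of `H`: the successor of `v` on a bypass of `c 0` is close to any
other such neighbour `s`, by counting at a vertex adjacent to `v` and at distance at most `2` from
`s`. -/
theorem OffCycle.notMem_M_three {l : ℕ} {c : ℤ → V} {H : Set V} (K : OffCycle G l c H)
    (hT : TripleBound G) {v s : V} (hv : IsAtt G H v) (hvH : v ∉ H) (hv0 : v ≠ c 0)
    (h0 : IsAtt G H (c 0)) (hs0 : G.Adj s (c 0)) (hsH : s ∉ H) (hs : ¬ IsAtt G H s) :
    s ∉ M G 3 v := by
  intro hsM
  have h3 := K.three
  obtain ⟨w, hvw, hsw⟩ := exists_center_of_mem_M_three hsM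
  obtain ⟨j, rfl⟩ := K.exists_eq_of_isAtt hv hvH
  obtain ⟨n, d', hB'⟩ := K.exists_isBypass hT h0
  have hlen := hB'.len
  obtain ⟨x, hx, hvx⟩ := hv
  have hv : IsAtt G H (c j) := ⟨x, hx, hvx⟩
  -- The successor of `v` on any parametrization of the bypass is close to `s`.
  have hclose : ∀ d k, IsBypass G l c H n d → d k = c j →
      d (k + 1) ∈ M G 2 s ∧ s ∈ M G 2 (d (k + 1)) := by
    intro d k hB hk
    obtain ⟨hp, -⟩ := K.bypass_succ hT h0 hB (hk ▸ hv)
    have hpw : d (k + 1) ∈ M G 2 w := mem_M_succ (hk ▸ hvw) (hB.cyc.adj k)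
    have huniq : ∀ (u : V) (i : ℤ), G.Adj x (c i) → c i ≠ c j → c i ≠ c j → ¬ G.Adj u (c i) :=
      fun u i h h' _ => absurd (K.eq_of_adj hT hx h hvx.symm) h'
    have hxw : x ∈ M G 2 w := mem_M_succ hvw hvx
    exact ⟨K.mem_M_two_of_center hT hx (hB.notMem _) hsH hp hs hpw hsw hxw (huniq _) (huniq _),
      K.mem_M_two_of_center hT hx hsH (hB.notMem _) hs hp hsw hpw hxw (huniq _) (huniq _)⟩
  by_cases hsd : s ∈ Set.range d'
  · obtain ⟨e, he⟩ := hsd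
    obtain ⟨d, hB, hd0⟩ : ∃ d, IsBypass G l c H n d ∧ d 0 = s :=
      ⟨_, hB'.shift e, by simpa using he⟩
    obtain ⟨i, hi⟩ := hB.cover j hv0
    obtain ⟨k, h1, h2, h4⟩ := hB.cyc.exists_mem_window (by omega) 0 i
    rw [hi] at h4
    have hk0 : k ≠ 0 := by
      rintro rfl
      rw [hd0] at h4
      exact hs (h4 ▸ hv)
    obtain ⟨y, hy, h0y⟩ := h0
    refine K.notMem_M_two hT hB hy h0y (hd0 ▸ hs0) (hd0 ▸ hs) (k := k) (by omega) (by omega)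
      (h4 ▸ hv) (fun m _ _ hm => ?_) (hd0 ▸ (hclose d k hB h4).1)
    obtain ⟨i, hi⟩ := (K.closed y hy _ hm).resolve_left (hB.notMem m)
    exact hB.avoid m (hi ▸ K.eq_of_adj hT hy (hi ▸ hm) h0y.symm)
  · obtain ⟨e, he⟩ := hB'.cover j hv0
    have hd0 : d' (0 + e) = c j := by simpa using he
    refine K.notMem_M_two_of_notMem_range hT (hB'.shift e) hx (hd0 ▸ hvx.symm) h0 hs0 hsH hs ?_ ?_
    · rintro ⟨i, hi⟩
      exact hsd ⟨_, hi⟩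
    · simpa using (hclose _ 0 (hB'.shift e) hd0).2

/-- Around an attachment `v`, the ball of radius `3` contains `H`-vertices and the successor of
`v`. As it is connected without `v`, it must contain a forbidden edge leaving a second
attachment. -/
theorem OffCycle.not_isKConnected {l : ℕ} {c : ℤ → V} {H : Set V} (K : OffCycle G l c H)
    (hT : TripleBound G) {v : V} (hv : IsAtt G H v) (hvH : v ∉ H) :
    ¬ IsKConnected 2 (ball G 3 v) := by
  intro hconn
  obtain ⟨i, rfl⟩ := K.exists_eq_of_isAtt hv hvH
  obtain ⟨x, hx, hvx⟩ := hv
  have hv : IsAtt G H (c i) := ⟨x, hx, hvx⟩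
  have hself : c i ∈ M G 3 (c i) := mem_M_self _ _
  have hc := hconn.2 {⟨c i, hself⟩} (by simp)
  have hmem : ∀ y (hy : G.Adj (c i) y), (⟨y, M_mono (by omega) (mem_M_one hy)⟩ : M G 3 (c i)) ∈
      ({⟨c i, hself⟩} : Set (M G 3 (c i)))ᶜ := by
    intro y hy h
    simp only [Set.mem_singleton_iff, Subtype.mk.injEq] at h
    exact hy.ne' h
  obtain ⟨q⟩ := hc.preconnected ⟨_, hmem x hvx⟩ ⟨_, hmem _ (K.cyc.adj i)⟩
  obtain ⟨e, -, he1, he2⟩ := q.exists_boundary_dart {y | IsAtt G H y.1.1} (K.nontriv x hx)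
    (K.not_isAtt_succ hv)
  have hadj : G.Adj e.fst.1.1 e.snd.1.1 := e.adj
  have hne : e.fst.1.1 ≠ c i := fun h => e.fst.2 (Subtype.ext h)
  have hsM : e.snd.1.1 ∈ M G 3 (c i) := e.snd.1.2
  simp only [Set.mem_ofPred_eq] at he1 he2
  generalize e.fst.1.1 = u at *
  generalize e.snd.1.1 = s at *
  have huH : u ∉ H := fun h => he2 ⟨u, h, hadj.symm⟩
  have hsH : s ∉ H := fun h => he2 (K.nontriv s h)
  obtain ⟨j, rfl⟩ := K.exists_eq_of_isAtt he1 huH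
  refine (K.shift j).notMem_M_three hT hv hvH ?_ ?_ ?_ hsH he2 hsM
  · simpa using hne.symm
  · simpa using he1
  · simpa using hadj.symm

end Cases

section LongestCycle

variable {V : Type*} {G : SimpleGraph V}

/-! ### From a longest cycle to a component off it -/

theorem IsLongestCycle.cycleBound {v : V} {C : G.Walk v v} (hC : IsLongestCycle G C) :
    CycleBound G C.length := by
  rintro a b n S ⟨p, hp, hn, -⟩ hba h3
  refine hn ▸ hC.2 b (.cons hba p) ((SimpleGraph.Walk.cons_isCycle_iff p hba).2 ⟨hp, fun h => ?_⟩)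
  have := hp.length_eq_one_of_mem_edges (Sym2.eq_swap ▸ h)
  omega

theorem _root_.SimpleGraph.Walk.IsCycle.exists_isCyc {v : V} {C : G.Walk v v} (hC : C.IsCycle) :
    ∃ c, IsCyc G C.length c ∧ Set.range c = {x | x ∈ C.support} := by
  have hnil := hC.not_nil
  have h := SimpleGraph.Walk.length_tail_add_one hnil
  obtain ⟨c, hc, hS⟩ := PathOn.exists_isCyc ⟨C.tail, hC.isPath_tail, h, rfl⟩ (C.adj_snd hnil)
  refine ⟨c, hc, hS.trans ?_⟩
  ext x
  rw [Set.mem_ofPred_eq, Set.mem_ofPred_eq, ← SimpleGraph.Walk.cons_support_tail hnil,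
    List.mem_cons]
  refine ⟨Or.inr, ?_⟩
  rintro (rfl | h)
  · exact C.tail.end_mem_support
  · exact h

/-- An edge off a longest cycle lies in a component off the cycle. -/
theorem exists_offCycle {l : ℕ} {c : ℤ → V} (hl : CycleBound G l) (h3 : 3 ≤ l) (hc : IsCyc G l c)
    {a b : V} (hab : G.Adj a b) (ha : a ∉ Set.range c) (hb : b ∉ Set.range c) :
    ∃ H, OffCycle G l c H ∧ a ∈ H := by
  classical
  let G' : SimpleGraph V :=
    { Adj := fun x y => G.Adj x y ∧ x ∉ Set.range c ∧ y ∉ Set.range c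
      symm := ⟨fun x y h => ⟨h.1.symm, h.2.2, h.2.1⟩⟩
      loopless := ⟨fun x h => h.1.ne rfl⟩ }
  have hle : G' ≤ G := fun _ _ h => h.1
  have hnontriv : ∀ x, G'.Reachable a x → ∃ y, G'.Adj x y := by
    rintro x ⟨p⟩
    cases p.reverse with
    | nil => exact ⟨b, hab, ha, hb⟩
    | cons h _ => exact ⟨_, h⟩
  refine ⟨{x | G'.Reachable a x}, ⟨hl, h3, hc, fun i hi => ?_, fun x hx y hxy => ?_,
    fun x hx y hy => ?_, fun x hx => ?_⟩, .refl a⟩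
  · obtain ⟨y, hy⟩ := hnontriv _ hi
    exact hy.2.1 ⟨i, rfl⟩
  · by_cases hy : y ∈ Set.range c
    · exact Or.inr hy
    · obtain ⟨z, hz⟩ := hnontriv x hx
      have hxy' : G'.Adj x y := ⟨hxy, hz.2.1, hy⟩
      exact Or.inl (hx.trans hxy'.reachable)
  · obtain ⟨p, hp⟩ := (hx.symm.trans hy).exists_isPath
    refine ⟨_, _, PathOn.mono hle ⟨p, hp, rfl, rfl⟩, fun z hz => ?_⟩
    exact hx.trans ⟨p.takeUntil z hz⟩
  · obtain ⟨y, hy⟩ := hnontriv x hx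
    exact ⟨y, hx.trans hy.reachable, hy.1⟩

end LongestCycle

end LocalBondy

theorem mainTheorem2 {V : Type*} [Fintype V] (G : SimpleGraph V) [DecidableRel G.Adj]
    (hconn : G.Connected) (hcard : 3 ≤ Fintype.card V)
    (hball : ∀ v : V, LocalBondy.IsKConnected 2 (LocalBondy.ball G 3 v))
    (hdeg : ∀ v x y z : V, x ∈ LocalBondy.M G 2 v → y ∈ LocalBondy.M G 2 v →
      z ∈ LocalBondy.M G 2 v → x ≠ y → y ≠ z → x ≠ z → G.IsIndepSet {x, y, z} →
      (LocalBondy.M G 3 v).ncard + 2 ≤ G.degree x + G.degree y + G.degree z) :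
    ∀ (c : V) (C : G.Walk c c),
      LocalBondy.IsLongestCycle G C → LocalBondy.IsDominating G C := by
  intro v C hC a ha b hb _ hab
  obtain ⟨c, hc, hr⟩ := hC.1.exists_isCyc
  have hmem : ∀ x, x ∉ C.support → x ∉ Set.range c := fun x hx h => hx (hr.subset h)
  obtain ⟨H, K, haH⟩ := LocalBondy.exists_offCycle hC.cycleBound hC.1.three_le_length hc hab
    (hmem a ha) (hmem b hb)
  obtain ⟨q⟩ := hconn.preconnected a (c 0)
  obtain ⟨e, -, he1, he2⟩ := q.exists_boundary_dart H haH (K.notMem 0)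
  exact K.not_isKConnected hdeg ⟨_, he1, e.adj.symm⟩ he2 (hball _)
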